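/- Let $p$ be an odd prime, let $F$ be a totally real number field, and let $F^{cyc}/F$ be its cyclotomic $\mathbb{Z}_p$-extension, that is, the unique Galois extension of $F$ inside $F(\mu_{p^\infty})$ whose Galois group is isomorphic to $\mathbb{Z}_p$. Let $F_\infty/F$ be an admissible $p$-adic Lie extension: a Galois extension that is unramified outside a finite set of primes of $F$, with $F_\infty$ totally real, with $F^{cyc}\subseteq F_\infty$, and such that $G=\mathrm{Gal}(F_\infty/F)$ is a $p$-adic Lie group ($G$ may have elements of order $p$). Put $H=\mathrm{Gal}(F_\infty/F^{cyc})$. For a profinite group $P$ let $\Lambda(P)=\varprojlim_U\mathbb{Z}_p[P/U]$, with $U$ running through the open normal subgroups of $P$. Let $$S=\{s\in\Lambda(G) : \Lambda(G)/\Lambda(G)s \text{ is a finitely generated } \Lambda(H)\text{-module}\},$$ let $\Lambda(G)_S$ be the localisation of $\Lambda(G)$ at $S$, and let $i:\Lambda(G)\to\Lambda(G)_S$ be the canonical homomorphism. All modules are left modules. For a ring $\Lambda$, $K_0(\Lambda)$ is the abelian group with generators $[P]$, for $P$ a finitely generated projective $\Lambda$-module, and relations $[P]=[Q]$ if $P\cong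 Q$ and $[P\oplus Q]=[P]+[Q]$; $K_1(\Lambda)$ is the abelian group with generators $[P,\alpha]$, for $\alpha$ an automorphism of a finitely generated projective module $P$, and relations invariance under isomorphism, $[P,\alpha\beta]=[P,\alpha][P,\beta]$ and $[P\oplus Q,\alpha\oplus\beta]=[P,\alpha][Q,\beta]$. The relative group $K_0(\Lambda(G),\Lambda(G)_S)$ has as generators the classes $[(P,\alpha,Q)]$ of triples of finitely generated projective $\Lambda(G)$-modules $P,Q$ and an isomorphism $\alpha:\Lambda(G)_S\otimes_{\Lambda(G)}P\to\Lambda(G)_S\otimes_{\Lambda(G)}Q$, with relations invariance under isomorphism of triples, additivity in short exact sequences of triples, and $[(P_1,\beta\circ\alpha,P_3)]=[(P_1,\alpha,P_2)]+[(P_2,\beta,P_3)]$. Let $\partial:K_1(\Lambda(G)_S)\to K_0(\Lambda(G),\Lambda(G)_S)$ be the connecting homomorphism, which sends the class of $\alpha\in GL_n(\Lambda(G)_S)$ to $[(\Lambda(G)^n,\alpha,\Lambda(G)^n)]$, and let $\eta:K_0(\Lambda(G),\Lambda(G)_S)\to K_0(\Lambda(G))$ be the homomorphism $[(P,\alpha,Q)]\mapsto[P]-[Q]$.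 Then $\partial$ is surjective and, equivalently, $\eta=0$. -/

import Mathlib

open scoped TensorProduct Manifold ContDiff NumberField

universe u v

namespace NCIwasawa

noncomputable section

/-! ### Finitely generated projective modules and `K₀` -/

/-- A finitely generated projective left module over the (not necessarily commutative) ring `R`. -/
structure FGProj (R : Type u) [Ring R] where
  carrier : Type u
  [addCommGroup : AddCommGroup carrier]
  [module : Module R carrier]
  [finite : Module.Finite R carrier]
  [projective : Module.Projective R carrier]

namespace FGProj

instance (R : Type u) [Ring R] : CoeSort (FGProj R) (Type u) := ⟨FGProj.carrier⟩

attribute [instance] addCommGroup module finite projective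

variable {R : Type u} [Ring R]

/-- The direct sum of two finitely generated projective modules. -/
abbrev prod (P Q : FGProj R) : FGProj R where
  carrier := P × Q

variable (R) in
/-- The free module `Rⁿ`. -/
abbrev free (n : ℕ) : FGProj R where
  carrier := Fin n → R

end FGProj

/-- The relations defining `K₀(R)`. -/
inductive K0Rel (R : Type u) [Ring R] : FreeAbelianGroup (FGProj R) → Prop
  | iso (P Q : FGProj R) (e : P ≃ₗ[R] Q) :
      K0Rel R (FreeAbelianGroup.of P - FreeAbelianGroup.of Q)
  | sum (P Q : FGProj R) :
      K0Rel R (FreeAbelianGroup.of (P.prod Q) -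
        (FreeAbelianGroup.of P + FreeAbelianGroup.of Q))

/-- `K₀(R)`: generators `[P]`, for `P` a finitely generated projective left `R`-module, subject to
`[P] = [Q]` for `P ≅ Q` and `[P ⊕ Q] = [P] + [Q]`. -/
abbrev K0 (R : Type u) [Ring R] : Type (u + 1) :=
  FreeAbelianGroup (FGProj R) ⧸ AddSubgroup.closure {x | K0Rel R x}

/-- The class `[P]` in `K₀(R)`. -/
def K0.mk {R : Type u} [Ring R] (P : FGProj R) : K0 R :=
  QuotientAddGroup.mk' (AddSubgroup.closure {x | K0Rel R x}) (FreeAbelianGroup.of P)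

theorem K0.mk_eq_of_equiv {R : Type u} [Ring R] {P Q : FGProj R} (e : P ≃ₗ[R] Q) :
    K0.mk P = K0.mk Q := by
  rw [← sub_eq_zero, K0.mk, K0.mk, ← map_sub]
  exact (QuotientAddGroup.eq_zero_iff _).2 (AddSubgroup.subset_closure (K0Rel.iso P Q e))

theorem K0.mk_prod {R : Type u} [Ring R] (P Q : FGProj R) :
    K0.mk (P.prod Q) = K0.mk P + K0.mk Q := by
  rw [← sub_eq_zero, K0.mk, K0.mk, K0.mk, ← map_add, ← map_sub]
  exact (QuotientAddGroup.eq_zero_iff _).2 (AddSubgroup.subset_closure (K0Rel.sum P Q))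

/-! ### `K₁` -/

/-- A pair `(P, α)`: a finitely generated projective module with an automorphism. -/
structure AutObj (R : Type u) [Ring R] where
  obj : FGProj R
  aut : obj ≃ₗ[R] obj

/-- The relations defining `K₁(R)`, with the group law written additively. -/
inductive K1Rel (R : Type u) [Ring R] : FreeAbelianGroup (AutObj R) → Prop
  | iso (P Q : FGProj R) (α : P ≃ₗ[R] P) (β : Q ≃ₗ[R] Q) (f : P ≃ₗ[R] Q)
      (comm : ∀ x, f (α x) = β (f x)) :
      K1Rel R (FreeAbelianGroup.of ⟨P, α⟩ - FreeAbelianGroup.of ⟨Q, β⟩)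
  | comp (P : FGProj R) (α β : P ≃ₗ[R] P) :
      K1Rel R (FreeAbelianGroup.of ⟨P, β.trans α⟩ -
        (FreeAbelianGroup.of ⟨P, α⟩ + FreeAbelianGroup.of ⟨P, β⟩))
  | sum (P Q : FGProj R) (α : P ≃ₗ[R] P) (β : Q ≃ₗ[R] Q) :
      K1Rel R (FreeAbelianGroup.of ⟨P.prod Q, LinearEquiv.prodCongr α β⟩ -
        (FreeAbelianGroup.of ⟨P, α⟩ + FreeAbelianGroup.of ⟨Q, β⟩))

/-- `K₁(R)`: generators `[P, α]`, for `α` an automorphism of a finitely generated projective left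
`R`-module `P`, subject to invariance under isomorphism, `[P, α ∘ β] = [P, α] + [P, β]` and
`[P ⊕ Q, α ⊕ β] = [P, α] + [Q, β]`. The group law is written additively. -/
abbrev K1 (R : Type u) [Ring R] : Type (u + 1) :=
  FreeAbelianGroup (AutObj R) ⧸ AddSubgroup.closure {x | K1Rel R x}

/-- The class `[P, α]` in `K₁(R)`. -/
def K1.mk {R : Type u} [Ring R] (P : FGProj R) (α : P ≃ₗ[R] P) : K1 R :=
  QuotientAddGroup.mk' (AddSubgroup.closure {x | K1Rel R x}) (FreeAbelianGroup.of ⟨P, α⟩)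

/-! ### Extension of scalars along a homomorphism of noncommutative rings -/

section BaseChange

variable {R R' : Type u} [Ring R] [Ring R'] (f : R →+* R')

/-- The relations `a f(r) ⊗ x = a ⊗ r x` that cut `R' ⊗_R P` out of `R' ⊗_ℤ P`. -/
def baseChangeRel (P : Type u) [AddCommGroup P] [Module R P] : Submodule R' (R' ⊗[ℤ] P) :=
  Submodule.span R' {t | ∃ (a : R') (r : R) (x : P), t = (a * f r) ⊗ₜ[ℤ] x - a ⊗ₜ[ℤ] (r • x)}

/-- The left `R'`-module `R' ⊗_R P`, for a ring homomorphism `f : R → R'` and a left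
`R`-module `P`. -/
abbrev BaseChange (P : Type u) [AddCommGroup P] [Module R P] : Type u :=
  (R' ⊗[ℤ] P) ⧸ baseChangeRel f P

namespace BaseChange

variable {P Q : Type u} [AddCommGroup P] [Module R P] [AddCommGroup Q] [Module R Q]

/-- The class of `a ⊗ x` in `R' ⊗_R P`. -/
def tmul (a : R') (x : P) : BaseChange f P :=
  (baseChangeRel f P).mkQ (a ⊗ₜ[ℤ] x)

theorem tmul_smul (a : R') (r : R) (x : P) : tmul f a (r • x) = tmul f (a * f r) x := by
  rw [tmul, tmul, eq_comm, ← sub_eq_zero, ← map_sub]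
  exact (Submodule.Quotient.mk_eq_zero _).2 (Submodule.subset_span ⟨a, r, x, rfl⟩)

theorem smul_tmul (b a : R') (x : P) : b • tmul f a x = tmul f (b * a) x := by
  rw [tmul, tmul, ← map_smul, TensorProduct.smul_tmul', smul_eq_mul]

/-- The canonical semilinear map `P → R' ⊗_R P`, `x ↦ 1 ⊗ x`. -/
def of (P : Type u) [AddCommGroup P] [Module R P] : P →ₛₗ[f] BaseChange f P where
  toFun x := tmul f 1 x
  map_add' x y := by simp only [tmul, TensorProduct.tmul_add, map_add]
  map_smul' r x := by rw [tmul_smul, smul_tmul, one_mul, mul_one]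

section lift

variable {M : Type u} [AddCommGroup M] [Module R' M]

/-- The universal property of `R' ⊗_R P`: an `f`-semilinear map `P → M` extends to an
`R'`-linear map `R' ⊗_R P → M`. -/
def lift (g : P →ₛₗ[f] M) : BaseChange f P →ₗ[R'] M :=
  (baseChangeRel f P).liftQ
    (TensorProduct.AlgebraTensorModule.lift
      (LinearMap.toSpanSingleton R' (P →ₗ[ℤ] M) g.toAddMonoidHom.toIntLinearMap)) (by
    rw [baseChangeRel, Submodule.span_le]
    rintro _ ⟨a, r, x, rfl⟩
    simp [mul_smul])

@[simp] theorem lift_of (g : P →ₛₗ[f] M) (x : P) : lift f g (of f P x) = g x := by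
  change (baseChangeRel f P).liftQ _ _ ((baseChangeRel f P).mkQ ((1 : R') ⊗ₜ[ℤ] x)) = g x
  simp

variable {f}

theorem hom_ext {g h : BaseChange f P →ₗ[R'] M} (H : ∀ x, g (of f P x) = h (of f P x)) :
    g = h := by
  refine Submodule.linearMap_qext (baseChangeRel f P) (LinearMap.ext fun t => ?_)
  induction t with
  | zero => simp
  | add s t hs ht => rw [map_add, map_add, hs, ht]
  | tmul a x =>
    have e : (a ⊗ₜ[ℤ] x : R' ⊗[ℤ] P) = a • ((1 : R') ⊗ₜ[ℤ] x) := by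
      rw [TensorProduct.smul_tmul', smul_eq_mul, mul_one]
    rw [e, map_smul, map_smul]
    exact congrArg (a • ·) (H x)

end lift

/-- Functoriality: `id ⊗ g : R' ⊗_R P → R' ⊗_R Q`. -/
def map (g : P →ₗ[R] Q) : BaseChange f P →ₗ[R'] BaseChange f Q :=
  lift f ((of f Q).comp g)

@[simp] theorem map_of (g : P →ₗ[R] Q) (x : P) : map f g (of f P x) = of f Q (g x) := by
  simp [map]

/-- `R' ⊗_R (P ⊕ Q) ≅ (R' ⊗_R P) ⊕ (R' ⊗_R Q)`. -/
def prodEquiv (P Q : Type u) [AddCommGroup P] [Module R P] [AddCommGroup Q] [Module R Q] :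
    BaseChange f (P × Q) ≃ₗ[R'] BaseChange f P × BaseChange f Q :=
  LinearEquiv.ofLinearMap
    ((map f (LinearMap.fst R P Q)).prod (map f (LinearMap.snd R P Q)))
    ((map f (LinearMap.inl R P Q)).coprod (map f (LinearMap.inr R P Q)))
    (by
      refine LinearMap.prod_ext (hom_ext fun x => ?_) (hom_ext fun x => ?_) <;> simp)
    (hom_ext fun x => by
      simp only [LinearMap.comp_apply, LinearMap.prod_apply, Function.prod_apply, map_of,
        LinearMap.coprod_apply, LinearMap.id_apply, ← map_add]
      simp)

/-- `R' ⊗_R Rⁿ ≅ R'ⁿ`. -/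
def freeEquiv (n : ℕ) : BaseChange f (Fin n → R) ≃ₗ[R'] (Fin n → R') :=
  LinearEquiv.ofLinearMap
    (lift f
      { toFun := fun w i => f (w i)
        map_add' := fun w w' => by ext i; simp
        map_smul' := fun r w => by ext i; simp })
    ((Pi.basisFun R' (Fin n)).constr ℤ fun i => of f (Fin n → R) (Pi.single i 1))
    (by
      refine (Pi.basisFun R' (Fin n)).ext fun i => ?_
      rw [LinearMap.comp_apply, Module.Basis.constr_basis, lift_of]
      ext j
      by_cases h : j = i
      · subst h; simp
      · simp [h])
    (hom_ext fun w => by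
      rw [LinearMap.comp_apply, lift_of, Module.Basis.constr_apply_fintype]
      conv_rhs => rw [LinearMap.id_apply, ← Finset.univ_sum_single w]
      rw [map_sum]
      refine Finset.sum_congr rfl fun i _ => ?_
      have : (Pi.single i (w i) : Fin n → R) = w i • Pi.single i (1 : R) := by
        rw [← Pi.single_smul', smul_eq_mul, mul_one]
      rw [this, LinearMap.map_smulₛₗ]
      simp)

theorem freeEquiv_of (n : ℕ) (w : Fin n → R) (i : Fin n) :
    freeEquiv f n (of f (Fin n → R) w) i = f (w i) := by
  simp [freeEquiv]

end BaseChange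

end BaseChange

/-! ### The relative group `K₀(f)` -/

section Relative

variable {R R' : Type u} [Ring R] [Ring R'] (f : R →+* R')

/-- A triple `(P, α, Q)`: finitely generated projective `R`-modules `P`, `Q` with an isomorphism
`α : R' ⊗_R P ≅ R' ⊗_R Q`. -/
structure RelObj where
  dom : FGProj R
  cod : FGProj R
  iso : BaseChange f dom ≃ₗ[R'] BaseChange f cod

namespace RelObj

variable {f}

/-- A pair `(g, h)` is a morphism of triples if `α' ∘ (id ⊗ g) = (id ⊗ h) ∘ α`. -/
def IsHom (X Y : RelObj f) (g : X.dom →ₗ[R] Y.dom) (h : X.cod →ₗ[R] Y.cod) : Prop :=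
  ∀ x, Y.iso (BaseChange.map f g x) = BaseChange.map f h (X.iso x)

end RelObj

/-- The relations defining `K₀(f)`. -/
inductive K0RelativeRel : FreeAbelianGroup (RelObj f) → Prop
  | iso (X Y : RelObj f) (g : X.dom ≃ₗ[R] Y.dom) (h : X.cod ≃ₗ[R] Y.cod)
      (hom : RelObj.IsHom X Y g h) :
      K0RelativeRel (FreeAbelianGroup.of X - FreeAbelianGroup.of Y)
  | exact (X' X X'' : RelObj f)
      (g₁ : X'.dom →ₗ[R] X.dom) (h₁ : X'.cod →ₗ[R] X.cod) (hom₁ : RelObj.IsHom X' X g₁ h₁)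
      (g₂ : X.dom →ₗ[R] X''.dom) (h₂ : X.cod →ₗ[R] X''.cod) (hom₂ : RelObj.IsHom X X'' g₂ h₂)
      (g_inj : Function.Injective g₁) (g_exact : Function.Exact g₁ g₂)
      (g_surj : Function.Surjective g₂)
      (h_inj : Function.Injective h₁) (h_exact : Function.Exact h₁ h₂)
      (h_surj : Function.Surjective h₂) :
      K0RelativeRel (FreeAbelianGroup.of X -
        (FreeAbelianGroup.of X' + FreeAbelianGroup.of X''))
  | comp (P₁ P₂ P₃ : FGProj R) (α : BaseChange f P₁ ≃ₗ[R'] BaseChange f P₂)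
      (β : BaseChange f P₂ ≃ₗ[R'] BaseChange f P₃) :
      K0RelativeRel (FreeAbelianGroup.of ⟨P₁, P₃, α.trans β⟩ -
        (FreeAbelianGroup.of ⟨P₁, P₂, α⟩ + FreeAbelianGroup.of ⟨P₂, P₃, β⟩))

/-- The relative group `K₀(f)` of a ring homomorphism `f : R → R'`, also written `K₀(R, R')`:
generators `[(P, α, Q)]`, subject to invariance under isomorphism, additivity in short exact
sequences and `[(P₁, β ∘ α, P₃)] = [(P₁, α, P₂)] + [(P₂, β, P₃)]`. -/
abbrev K0Relative : Type (u + 1) :=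
  FreeAbelianGroup (RelObj f) ⧸ AddSubgroup.closure {x | K0RelativeRel f x}

/-- The class `[(P, α, Q)]` in `K₀(f)`. -/
def K0Relative.mk (X : RelObj f) : K0Relative f :=
  QuotientAddGroup.mk' (AddSubgroup.closure {x | K0RelativeRel f x}) (FreeAbelianGroup.of X)

/-- The class `[(P, α, P)]` of an automorphism `α` of `R' ⊗_R P`. -/
def K0Relative.ofAut (P : FGProj R) (α : BaseChange f P ≃ₗ[R'] BaseChange f P) :
    K0Relative f :=
  K0Relative.mk f ⟨P, P, α⟩

/-! ### The homomorphism `η : K₀(f) → K₀(R)` -/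

/-- `η : K₀(f) → K₀(R)`, `[(P, α, Q)] ↦ [P] - [Q]`. -/
def eta : K0Relative f →+ K0 R :=
  QuotientAddGroup.lift (AddSubgroup.closure {x | K0RelativeRel f x})
    (FreeAbelianGroup.lift fun X : RelObj f => K0.mk X.dom - K0.mk X.cod) (by
      have split : ∀ {A B C : FGProj R} (g : A →ₗ[R] B) (h : B →ₗ[R] C),
          Function.Injective g → Function.Exact g h → Function.Surjective h →
          K0.mk B = K0.mk A + K0.mk C := by
        intro A B C g h hg he hh
        obtain ⟨l, hl⟩ := Module.projective_lifting_property h LinearMap.id hh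
        rw [← K0.mk_prod]
        exact K0.mk_eq_of_equiv (he.splitSurjectiveEquiv hg ⟨l, hl⟩).1
      rw [AddSubgroup.closure_le]
      rintro x (⟨X, Y, g, h, -⟩ | ⟨X', X, X'', g₁, h₁, -, g₂, h₂, -, gi, ge, gs, hi, he, hs⟩ |
        ⟨P₁, P₂, P₃, α, β⟩)
      · simp [K0.mk_eq_of_equiv g, K0.mk_eq_of_equiv h]
      · simp only [SetLike.mem_coe, AddMonoidHom.mem_ker, map_sub, map_add,
          FreeAbelianGroup.lift_apply_of, split g₁ g₂ gi ge gs, split h₁ h₂ hi he hs]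
        abel
      · simp only [SetLike.mem_coe, AddMonoidHom.mem_ker, map_sub, map_add,
          FreeAbelianGroup.lift_apply_of]
        abel)

theorem eta_mk (X : RelObj f) : eta f (K0Relative.mk f X) = K0.mk X.dom - K0.mk X.cod :=
  FreeAbelianGroup.lift_apply_of _ _

/-! ### The connecting homomorphism `∂ : K₁(R') → K₀(f)` -/

namespace K0Relative

theorem ofAut_trans (P : FGProj R) (α β : BaseChange f P ≃ₗ[R'] BaseChange f P) :
    ofAut f P (α.trans β) = ofAut f P α + ofAut f P β := by
  rw [← sub_eq_zero, ofAut, ofAut, ofAut, mk, mk, mk, ← map_add, ← map_sub]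
  exact (QuotientAddGroup.eq_zero_iff _).2
    (AddSubgroup.subset_closure (K0RelativeRel.comp P P P α β))

theorem ofAut_refl (P : FGProj R) : ofAut f P (LinearEquiv.refl R' _) = 0 := by
  have h := ofAut_trans f P (LinearEquiv.refl R' _) (LinearEquiv.refl R' _)
  rw [LinearEquiv.refl_trans] at h
  exact left_eq_add.1 h

theorem ofAut_conj (P : FGProj R) (γ α : BaseChange f P ≃ₗ[R'] BaseChange f P) :
    ofAut f P (γ.trans (α.trans γ.symm)) = ofAut f P α := by
  have h := ofAut_trans f P γ γ.symm
  rw [LinearEquiv.self_trans_symm, ofAut_refl] at h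
  rw [ofAut_trans, ofAut_trans, add_left_comm, ← h, add_zero]

theorem ofAut_prod (P Q : FGProj R) (α : BaseChange f P ≃ₗ[R'] BaseChange f P)
    (β : BaseChange f Q ≃ₗ[R'] BaseChange f Q) :
    ofAut f (P.prod Q) ((BaseChange.prodEquiv f P Q).trans
      ((LinearEquiv.prodCongr α β).trans (BaseChange.prodEquiv f P Q).symm)) =
      ofAut f P α + ofAut f Q β := by
  rw [← sub_eq_zero, ofAut, ofAut, ofAut, mk, mk, mk, ← map_add, ← map_sub]
  refine (QuotientAddGroup.eq_zero_iff _).2 (AddSubgroup.subset_closure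
    (K0RelativeRel.exact ⟨P, P, α⟩ ⟨P.prod Q, P.prod Q, _⟩ ⟨Q, Q, β⟩
      (LinearMap.inl R P Q) (LinearMap.inl R P Q) ?_ (LinearMap.snd R P Q) (LinearMap.snd R P Q)
      ?_ LinearMap.inl_injective Function.Exact.inl_snd LinearMap.snd_surjective
      LinearMap.inl_injective Function.Exact.inl_snd LinearMap.snd_surjective))
  · intro x
    have h1 : ∀ y : BaseChange f P, BaseChange.map f (LinearMap.inl R P Q) y =
        (BaseChange.prodEquiv f P Q).symm (y, 0) := fun y => by
      simp [BaseChange.prodEquiv]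
    change (BaseChange.prodEquiv f P Q).symm ((LinearEquiv.prodCongr α β)
      (BaseChange.prodEquiv f P Q (BaseChange.map f (LinearMap.inl R P Q) x))) = _
    rw [h1, h1, LinearEquiv.apply_symm_apply]
    simp
  · intro x
    have h1 : ∀ y : BaseChange f (P × Q), BaseChange.map f (LinearMap.snd R P Q) y =
        (BaseChange.prodEquiv f P Q y).2 := fun y => rfl
    change β (BaseChange.map f (LinearMap.snd R P Q) x) =
      BaseChange.map f (LinearMap.snd R P Q) ((BaseChange.prodEquiv f P Q).symm
        ((LinearEquiv.prodCongr α β) (BaseChange.prodEquiv f P Q x)))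
    rw [h1, h1, LinearEquiv.apply_symm_apply]
    rfl

end K0Relative

/-- A finitely generated projective `R'`-module `P'` presented as a direct summand of a module
`R' ⊗_R P`. -/
structure Presentation (P' : FGProj R') where
  base : FGProj R
  compl : FGProj R'
  equiv : BaseChange f base ≃ₗ[R'] (P' × compl)

namespace Presentation

variable {f}

/-- The class `[(P, α ⊕ id, P)]` in `K₀(f)`, where `R' ⊗_R P ≅ P' ⊕ Q'` and `α` is an
automorphism of `P'`. -/
def cls {P' : FGProj R'} (X : Presentation f P') (α : P' ≃ₗ[R'] P') : K0Relative f :=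
  K0Relative.ofAut f X.base
    (X.equiv.trans ((LinearEquiv.prodCongr α (LinearEquiv.refl R' X.compl)).trans X.equiv.symm))

theorem cls_trans {P' : FGProj R'} (X : Presentation f P') (α β : P' ≃ₗ[R'] P') :
    X.cls (α.trans β) = X.cls α + X.cls β := by
  rw [cls, cls, cls, ← K0Relative.ofAut_trans]
  congr 1
  ext x
  simp

theorem cls_eq {P' : FGProj R'} (X Y : Presentation f P') (α : P' ≃ₗ[R'] P') :
    X.cls α = Y.cls α := by
  have hX := K0Relative.ofAut_prod f X.base Y.base
    (X.equiv.trans ((LinearEquiv.prodCongr α (LinearEquiv.refl R' X.compl)).trans X.equiv.symm))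
    (LinearEquiv.refl R' _)
  have hY := K0Relative.ofAut_prod f X.base Y.base (LinearEquiv.refl R' _)
    (Y.equiv.trans ((LinearEquiv.prodCongr α (LinearEquiv.refl R' Y.compl)).trans Y.equiv.symm))
  rw [K0Relative.ofAut_refl, add_zero] at hX
  rw [K0Relative.ofAut_refl, zero_add] at hY
  rw [cls, cls, ← hX, ← hY]
  let E := (BaseChange.prodEquiv f X.base Y.base).trans (LinearEquiv.prodCongr X.equiv Y.equiv)
  let σ : ((P' × X.compl) × (P' × Y.compl)) ≃ₗ[R'] ((P' × X.compl) × (P' × Y.compl)) :=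
    { toFun := fun t => ((t.2.1, t.1.2), (t.1.1, t.2.2))
      invFun := fun t => ((t.2.1, t.1.2), (t.1.1, t.2.2))
      map_add' := fun _ _ => rfl
      map_smul' := fun _ _ => rfl
      left_inv := fun _ => rfl
      right_inv := fun _ => rfl }
  rw [← K0Relative.ofAut_conj f (X.base.prod Y.base) (E.trans (σ.trans E.symm))]
  congr 1
  apply LinearEquiv.ext
  intro x
  obtain ⟨t, rfl⟩ := E.symm.surjective x
  apply E.injective
  simp only [LinearEquiv.trans_apply, LinearEquiv.apply_symm_apply]
  simp [E, σ]

theorem cls_iso {P' Q' : FGProj R'} (X : Presentation f P') (Y : Presentation f Q')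
    (α : P' ≃ₗ[R'] P') (β : Q' ≃ₗ[R'] Q') (e : P' ≃ₗ[R'] Q') (comm : ∀ x, e (α x) = β (e x)) :
    X.cls α = Y.cls β := by
  rw [cls_eq Y ⟨X.base, X.compl, X.equiv.trans (LinearEquiv.prodCongr e (LinearEquiv.refl R' _))⟩,
    cls, cls]
  congr 1
  ext x
  simp [← comm]

theorem cls_sum {P' Q' : FGProj R'} (X : Presentation f P') (Y : Presentation f Q')
    (Z : Presentation f (P'.prod Q')) (α : P' ≃ₗ[R'] P') (β : Q' ≃ₗ[R'] Q') :
    Z.cls (LinearEquiv.prodCongr α β) = X.cls α + Y.cls β := by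
  let e : BaseChange f (X.base.prod Y.base) ≃ₗ[R'] ((P'.prod Q') × (X.compl.prod Y.compl)) :=
    ((BaseChange.prodEquiv f X.base Y.base).trans
      (LinearEquiv.prodCongr X.equiv Y.equiv)).trans
      (LinearEquiv.prodProdProdComm R' P' X.compl Q' Y.compl)
  rw [cls_eq Z ⟨X.base.prod Y.base, X.compl.prod Y.compl, e⟩, cls, cls, cls,
    ← K0Relative.ofAut_prod]
  congr 1

/-- `R'ⁿ` presented as `R' ⊗_R Rⁿ`. -/
def free (n : ℕ) : Presentation f (FGProj.free R' n) where
  base := FGProj.free R n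
  compl := FGProj.free R' 0
  equiv := (BaseChange.freeEquiv f n).trans
    (LinearEquiv.prodUnique (R := R') (M := Fin n → R') (M₂ := Fin 0 → R')).symm

variable (f) in
theorem nonempty (P' : FGProj R') : Nonempty (Presentation f P') := by
  obtain ⟨n, g, hg⟩ := Module.Finite.exists_fin' R' P'
  obtain ⟨l, hl⟩ := Module.projective_lifting_property g LinearMap.id hg
  have hex : Function.Exact (LinearMap.ker g).subtype g := LinearMap.exact_subtype_ker_map g
  let e : (Fin n → R') ≃ₗ[R'] (LinearMap.ker g × P') :=
    (hex.splitSurjectiveEquiv (Submodule.subtype_injective _) ⟨l, hl⟩).1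
  have : Module.Finite R' (LinearMap.ker g) :=
    Module.Finite.of_surjective (LinearMap.fst R' (LinearMap.ker g) P' ∘ₗ e.toLinearMap)
      ((LinearMap.fst_surjective (R := R') (M := LinearMap.ker g) (M₂ := P')).comp e.surjective)
  have : Module.Projective R' (LinearMap.ker g) :=
    Module.Projective.of_split (e.symm.toLinearMap ∘ₗ LinearMap.inl R' (LinearMap.ker g) P')
      (LinearMap.fst R' (LinearMap.ker g) P' ∘ₗ e.toLinearMap) (by ext x; simp)
  exact ⟨⟨FGProj.free R n, ⟨LinearMap.ker g⟩,
    (BaseChange.freeEquiv f n).trans (e.trans (LinearEquiv.prodComm R' _ _))⟩⟩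

end Presentation

/-- The connecting homomorphism `∂ : K₁(R') → K₀(f)`. It sends `[P', α]` to
`[(P, α ⊕ id, P)]` for any finitely generated projective `R`-module `P` with an isomorphism
`R' ⊗_R P ≅ P' ⊕ Q'`; in particular it sends the class of `α ∈ GLₙ(R')` to `[(Rⁿ, α, Rⁿ)]`. -/
def boundary : K1 R' →+ K0Relative f :=
  QuotientAddGroup.lift (AddSubgroup.closure {x | K1Rel R' x})
    (FreeAbelianGroup.lift fun A : AutObj R' =>
      (Presentation.nonempty f A.obj).some.cls A.aut) (by
      rw [AddSubgroup.closure_le]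
      rintro x (⟨P, Q, α, β, e, comm⟩ | ⟨P, α, β⟩ | ⟨P, Q, α, β⟩)
      · simp only [SetLike.mem_coe, AddMonoidHom.mem_ker, map_sub,
          FreeAbelianGroup.lift_apply_of]
        rw [sub_eq_zero]
        exact Presentation.cls_iso _ _ α β e comm
      · simp only [SetLike.mem_coe, AddMonoidHom.mem_ker, map_sub, map_add,
          FreeAbelianGroup.lift_apply_of]
        rw [Presentation.cls_trans, sub_eq_zero, add_comm]
      · simp only [SetLike.mem_coe, AddMonoidHom.mem_ker, map_sub, map_add,
          FreeAbelianGroup.lift_apply_of]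
        rw [sub_eq_zero]
        exact Presentation.cls_sum _ _ _ α β)

theorem boundary_mk {P' : FGProj R'} (X : Presentation f P') (α : P' ≃ₗ[R'] P') :
    boundary f (K1.mk P' α) = X.cls α :=
  (FreeAbelianGroup.lift_apply_of _ _).trans (Presentation.cls_eq _ _ _)

/-- `∂` sends the class of an automorphism `α` of `R'ⁿ` to `[(Rⁿ, α, Rⁿ)]`. -/
theorem boundary_free (n : ℕ) (α : (Fin n → R') ≃ₗ[R'] (Fin n → R')) :
    boundary f (K1.mk (FGProj.free R' n) α) =
      K0Relative.mk f ⟨FGProj.free R n, FGProj.free R n, (BaseChange.freeEquiv f n).trans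
        (α.trans (BaseChange.freeEquiv f n).symm)⟩ := by
  rw [boundary_mk f (Presentation.free n), Presentation.cls, K0Relative.ofAut]
  congr 2

end Relative

/-! ### Localisation of a noncommutative ring at a set of elements -/

section Loc

variable {R : Type u} [Ring R] (S : Set R)

/-- The relations defining the localisation: generators `[r]` for `r ∈ R`, which multiply and add
as in `R`, and `s⁻¹` for `s ∈ S`, which is a two-sided inverse of `[s]`. -/
inductive LocRel : FreeAlgebra ℤ (R ⊕ S) → FreeAlgebra ℤ (R ⊕ S) → Prop
  | one : LocRel (FreeAlgebra.ι ℤ (Sum.inl 1)) 1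
  | mul (a b : R) : LocRel (FreeAlgebra.ι ℤ (Sum.inl (a * b)))
      (FreeAlgebra.ι ℤ (Sum.inl a) * FreeAlgebra.ι ℤ (Sum.inl b))
  | add (a b : R) : LocRel (FreeAlgebra.ι ℤ (Sum.inl (a + b)))
      (FreeAlgebra.ι ℤ (Sum.inl a) + FreeAlgebra.ι ℤ (Sum.inl b))
  | inv_mul (s : S) : LocRel
      (FreeAlgebra.ι ℤ (Sum.inr s) * FreeAlgebra.ι ℤ (Sum.inl (s : R))) 1
  | mul_inv (s : S) : LocRel
      (FreeAlgebra.ι ℤ (Sum.inl (s : R)) * FreeAlgebra.ι ℤ (Sum.inr s)) 1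

/-- The localisation `R_S`: the universal ring under `R` in which the elements of `S` become
invertible. If `S` is a multiplicatively closed Ore set, this is the ring of fractions
`s⁻¹ r` (see `locEquivOre`). -/
abbrev Loc : Type u := RingQuot (LocRel S)

/-- The canonical homomorphism `R → R_S`. -/
def toLoc : R →+* Loc S where
  toFun r := RingQuot.mkRingHom (LocRel S) (FreeAlgebra.ι ℤ (Sum.inl r))
  map_one' := (RingQuot.mkRingHom_rel LocRel.one).trans (map_one _)
  map_mul' a b := (RingQuot.mkRingHom_rel (LocRel.mul a b)).trans (map_mul _ _ _)
  map_add' a b := (RingQuot.mkRingHom_rel (LocRel.add a b)).trans (map_add _ _ _)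
  map_zero' := by
    have h := (RingQuot.mkRingHom_rel (LocRel.add (S := S) 0 0)).trans (map_add _ _ _)
    rw [add_zero] at h
    exact left_eq_add.1 h

theorem isUnit_toLoc {s : R} (hs : s ∈ S) : IsUnit (toLoc S s) :=
  ⟨⟨toLoc S s, RingQuot.mkRingHom (LocRel S) (FreeAlgebra.ι ℤ (Sum.inr ⟨s, hs⟩)),
    (map_mul _ _ _).symm.trans ((RingQuot.mkRingHom_rel (LocRel.mul_inv ⟨s, hs⟩)).trans
      (map_one _)),
    (map_mul _ _ _).symm.trans ((RingQuot.mkRingHom_rel (LocRel.inv_mul ⟨s, hs⟩)).trans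
      (map_one _))⟩, rfl⟩

variable {S}

/-- The universal property of `R_S`. -/
theorem existsUnique_lift {A : Type v} [Ring A] (g : R →+* A) (hg : ∀ s ∈ S, IsUnit (g s)) :
    ∃! h : Loc S →+* A, h.comp (toLoc S) = g := by
  let g' : FreeAlgebra ℤ (R ⊕ S) →+* A :=
    (FreeAlgebra.lift ℤ (Sum.elim g fun s : S => ((hg s s.2).unit⁻¹ : Aˣ)) :
      FreeAlgebra ℤ (R ⊕ S) →ₐ[ℤ] A)
  have hg' : ∀ ⦃x y⦄, LocRel S x y → g' x = g' y := by
    rintro _ _ (_ | _ | _ | _ | _) <;> simp [g']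
  refine ⟨RingQuot.lift ⟨g', hg'⟩, ?_, ?_⟩
  · ext r
    exact (RingQuot.lift_mkRingHom_apply g' hg' _).trans (by simp [g'])
  · intro h hh
    refine RingQuot.ringQuot_ext _ _ ?_
    have key : ∀ x, (h.comp (RingQuot.mkRingHom (LocRel S))) x = g' x := by
      have : (h.comp (RingQuot.mkRingHom (LocRel S))).toIntAlgHom = g'.toIntAlgHom := by
        refine FreeAlgebra.hom_ext (funext ?_)
        rintro (r | s)
        · have e2 : g' (FreeAlgebra.ι ℤ (Sum.inl r)) = g r := by simp [g']
          exact (DFunLike.congr_fun hh r).trans e2.symm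
        · have e1 : h (RingQuot.mkRingHom (LocRel S) (FreeAlgebra.ι ℤ (Sum.inr s))) *
              g s = 1 := by
            rw [← hh]
            exact (map_mul h _ _).symm.trans ((congrArg h ((map_mul _ _ _).symm.trans
              ((RingQuot.mkRingHom_rel (LocRel.inv_mul s)).trans (map_one _)))).trans
              (map_one h))
          have e2 : g' (FreeAlgebra.ι ℤ (Sum.inr s)) = ((hg s s.2).unit⁻¹ : Aˣ) := by simp [g']
          change h (RingQuot.mkRingHom (LocRel S) (FreeAlgebra.ι ℤ (Sum.inr s))) =
            g' (FreeAlgebra.ι ℤ (Sum.inr s))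
          rw [e2]
          exact Units.eq_inv_of_mul_eq_one_right (u := (hg s s.2).unit) e1
      exact fun x => DFunLike.congr_fun this x
    ext x
    rw [key]
    exact (RingQuot.lift_mkRingHom_apply g' hg' x).symm

/-- At an Ore set, `R_S` is the Ore localisation. -/
theorem locEquivOre (S : Submonoid R) [OreLocalization.OreSet S] :
    ∃ e : Loc (S : Set R) ≃+* OreLocalization S R,
      ∀ r, e (toLoc (S : Set R) r) = OreLocalization.numeratorHom r := by
  obtain ⟨a, ha, -⟩ := existsUnique_lift (S := (S : Set R))
    (OreLocalization.numeratorRingHom (R := R) (S := S))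
    (fun s hs => OreLocalization.numerator_isUnit (⟨s, hs⟩ : S))
  let fS : S →* (Loc (S : Set R))ˣ :=
    IsUnit.liftRight ((toLoc (S : Set R)).toMonoidHom.comp S.subtype)
      fun s => isUnit_toLoc (S : Set R) s.2
  have hfS : ∀ s : S, toLoc (S : Set R) s = fS s := fun s => rfl
  let b := OreLocalization.universalHom (toLoc (S : Set R)) fS hfS
  have hb : ∀ r, b (OreLocalization.numeratorHom r) = toLoc (S : Set R) r := fun r =>
    OreLocalization.universalHom_commutes (toLoc (S : Set R)) fS hfS
  have ha' : ∀ r, a (toLoc (S : Set R) r) = OreLocalization.numeratorHom r :=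
    fun r => DFunLike.congr_fun ha r
  have hba : b.comp a = RingHom.id _ :=
    (existsUnique_lift (toLoc (S : Set R)) fun s hs => isUnit_toLoc (S : Set R) hs).unique
      (RingHom.ext fun r => (congrArg b (ha' r)).trans (hb r)) (RingHom.id_comp _)
  have hab : a.comp b = RingHom.id _ := by
    let gS : S →* (OreLocalization S R)ˣ :=
      IsUnit.liftRight ((OreLocalization.numeratorRingHom (R := R) (S := S)).toMonoidHom.comp
        S.subtype) fun s => OreLocalization.numerator_isUnit s
    have hgS : ∀ s : S, OreLocalization.numeratorRingHom (R := R) (S := S) s = gS s :=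
      fun s => rfl
    rw [OreLocalization.universalHom_unique _ gS hgS (a.comp b)
        fun r => (congrArg a (hb r)).trans (ha' r),
      OreLocalization.universalHom_unique _ gS hgS (RingHom.id _) fun r => rfl]
  exact ⟨RingEquiv.ofRingHom a b hab hba, ha'⟩

end Loc

/-! ### Iwasawa algebras -/

section Iwasawa

variable (p : ℕ) [Fact p.Prime]

/-- The transition map `ℤ_p[G/U] → ℤ_p[G/V]` for `U ⊆ V`. -/
def transition {G : Type u} [Group G] [TopologicalSpace G] (U V : OpenNormalSubgroup G)
    (h : U ≤ V) :
    MonoidAlgebra ℤ_[p] (G ⧸ U.toSubgroup) →+* MonoidAlgebra ℤ_[p] (G ⧸ V.toSubgroup) :=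
  MonoidAlgebra.mapDomainRingHom ℤ_[p]
    (QuotientGroup.map U.toSubgroup V.toSubgroup (MonoidHom.id G) h)

/-- The Iwasawa algebra `Λ(G) = lim ℤ_p[G/U]`, the inverse limit over the open normal subgroups
`U` of `G`, as the ring of compatible families. -/
def iwasawaSubring (G : Type u) [Group G] [TopologicalSpace G] :
    Subring (∀ U : OpenNormalSubgroup G, MonoidAlgebra ℤ_[p] (G ⧸ U.toSubgroup)) where
  carrier := {x | ∀ (U V : OpenNormalSubgroup G) (h : U ≤ V), transition p U V h (x U) = x V}
  mul_mem' hx hy U V h := by rw [Pi.mul_apply, Pi.mul_apply, map_mul, hx U V h, hy U V h]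
  one_mem' U V h := by rw [Pi.one_apply, Pi.one_apply, map_one]
  add_mem' hx hy U V h := by rw [Pi.add_apply, Pi.add_apply, map_add, hx U V h, hy U V h]
  zero_mem' U V h := by rw [Pi.zero_apply, Pi.zero_apply, map_zero]
  neg_mem' hx U V h := by rw [Pi.neg_apply, Pi.neg_apply, map_neg, hx U V h]

/-- The Iwasawa algebra `Λ(G)`. -/
def Lambda (G : Type u) [Group G] [TopologicalSpace G] : Type u := iwasawaSubring p G

instance (G : Type u) [Group G] [TopologicalSpace G] : Ring (Lambda p G) :=
  inferInstanceAs (Ring (iwasawaSubring p G))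

variable {G : Type u} [Group G] [TopologicalSpace G] (H : Subgroup G)

/-- The open normal subgroup `U ∩ H` of `H`. -/
def restrictOpen (U : OpenNormalSubgroup G) : OpenNormalSubgroup H where
  toOpenSubgroup := U.toOpenSubgroup.comap H.subtype continuous_subtype_val
  isNormal' := Subgroup.normal_comap (H := U.toSubgroup) H.subtype

/-- The map `ℤ_p[H/(U ∩ H)] → ℤ_p[G/U]` induced by the inclusion. -/
def inclLevel (U : OpenNormalSubgroup G) :
    MonoidAlgebra ℤ_[p] (H ⧸ (restrictOpen H U).toSubgroup) →+*
      MonoidAlgebra ℤ_[p] (G ⧸ U.toSubgroup) :=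
  MonoidAlgebra.mapDomainRingHom ℤ_[p]
    (QuotientGroup.map (restrictOpen H U).toSubgroup U.toSubgroup H.subtype fun _ hx => hx)

/-- The homomorphism `Λ(H) → Λ(G)` induced by the inclusion of the subgroup `H` in `G`. -/
def lambdaIncl : Lambda p H →+* Lambda p G where
  toFun x := ⟨fun U => inclLevel p H U (x.1 (restrictOpen H U)), fun U V h => by
    have h' : restrictOpen H U ≤ restrictOpen H V := fun y hy => h hy
    change transition p U V h (inclLevel p H U (x.1 (restrictOpen H U))) =
      inclLevel p H V (x.1 (restrictOpen H V))
    rw [← x.2 _ _ h']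
    simp only [transition, inclLevel, ← RingHom.comp_apply, ← MonoidAlgebra.mapDomainRingHom_comp]
    congr 2
    ext y
    rfl⟩
  map_one' := Subtype.ext (funext fun _ => map_one _)
  map_mul' _ _ := Subtype.ext (funext fun _ => map_mul _ _ _)
  map_zero' := Subtype.ext (funext fun _ => map_zero _)
  map_add' _ _ := Subtype.ext (funext fun _ => map_add _ _ _)

/-- For a ring homomorphism `f : A → R`, the set of all `s ∈ R` such that `R/Rs` is finitely
generated as a left `A`-module. -/
def finiteQuotientSet {A R : Type u} [Ring A] [Ring R] (f : A →+* R) : Set R :=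
  {s | letI : Module A (R ⧸ Submodule.span R {s}) := Module.compHom (R ⧸ Submodule.span R {s}) f
    Module.Finite A (R ⧸ Submodule.span R {s})}

/-- The set `S` of all `s ∈ Λ(G)` such that `Λ(G)/Λ(G)s` is a finitely generated left
`Λ(H)`-module. The localisation `Λ(G)_S` is `Loc (canonicalOreSet p H)`. -/
def canonicalOreSet : Set (Lambda p G) :=
  finiteQuotientSet (lambdaIncl p H)

end Iwasawa

/-! ### Admissible `p`-adic Lie extensions -/

section Admissible

variable (p : ℕ) [Fact p.Prime]

/-- A topological group is a `p`-adic Lie group if it carries the structure of a (finite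
dimensional) analytic Lie group over `ℚ_p` that induces its topology. -/
def IsPadicLieGroup (G : Type u) [Group G] [TopologicalSpace G] : Prop :=
  ∃ (d : ℕ) (_ : ChartedSpace (Fin d → ℚ_[p]) G), LieGroup 𝓘(ℚ_[p], Fin d → ℚ_[p]) ω G

variable (F : Type v) [Field F]

/-- `F(μ_{p^∞})`, inside an algebraic closure of `F`. -/
def adjoinRootsOfUnity : IntermediateField F (AlgebraicClosure F) :=
  IntermediateField.adjoin F {ζ | ∃ n : ℕ, ζ ^ p ^ n = 1}

/-- `C/F` is the cyclotomic `ℤ_p`-extension of `F`: a Galois extension of `F` contained in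
`F(μ_{p^∞})`, with Galois group isomorphic to the additive group `ℤ_p` as a topological group. -/
structure IsCyclotomicZpExtension (C : Type u) [Field C] [Algebra F C] : Prop where
  isGalois : IsGalois F C
  embeds : Nonempty (C →ₐ[F] adjoinRootsOfUnity p F)
  galois_group : Nonempty (Gal(C/F) ≃ₜ* Multiplicative ℤ_[p])

/-- `L/F` is an admissible `p`-adic Lie extension of the number field `F`, with
cyclotomic `ℤ_p`-extension `Fcyc ⊆ L`. -/
structure IsAdmissible [NumberField F] (L : Type u) [Field L] [Algebra F L]
    (Fcyc : IntermediateField F L) : Prop where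
  isGalois : IsGalois F L
  /-- All primes outside a finite set are unramified in every finite subextension. -/
  unramified : ∃ T : Set (IsDedekindDomain.HeightOneSpectrum (𝓞 F)), T.Finite ∧
    ∀ v ∉ T, ∀ K : IntermediateField F L, FiniteDimensional F K →
      Algebra.IsUnramifiedIn (𝓞 K) v.asIdeal
  totallyReal : NumberField.IsTotallyReal L
  padicLie : IsPadicLieGroup p Gal(L/F)
  cyclotomic : IsCyclotomicZpExtension p F Fcyc

end Admissible

end

end NCIwasawa

/-!
The point is that finitely generated projective `Λ(G)`-modules `P`, `Q` which become isomorphic over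
`Λ(G)_S` are already isomorphic (`nonempty_linearEquiv_of_baseChange`). Given this, `η` vanishes on
generators, and every triple `(P, α, Q)` is isomorphic to a triple `(P, β, P)`, whose class is the
image under `∂` of the automorphism `β` of the projective module `Λ(G)_S ⊗ P`.

To prove `P ≅ Q` it is enough, by compactness of `Λ(G)`, to construct isomorphisms modulo the
kernels of the maps `Λ(G) → (ℤ/pⁿ)[G/U]` (`nonempty_linearEquiv_of_mod`). Over a finite quotient
ring one counts homomorphisms: if `P` and `Q` have equally many homomorphisms to every finite
module, they have equally many surjections onto every finite module, and so they surject onto each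
other (`card_surjective_eq`, `exists_equiv_mod`). As `Hom(P, -)` is exact, it suffices to count
homomorphisms to finite modules `V` that are killed by `p` and on which an open subgroup of `G` acts
trivially.

For such `V` let `G` act on `V⟦X⟧` by the given action twisted by `g ↦ (1 + X) ^ χ(g)`, where
`χ : G → Gal(F^cyc/F) ≅ ℤ_p` is the projection. The action extends to `Λ(G)` (`exists_deformation`).
An element `s` of `S` acts invertibly on `V((X))`: for `w` with `s w = 0` the module `Λ(G) w` is
finitely generated over `Λ(H)`, which acts through a finite ring, so it is finite; but an element
`γ` with `χ(γ) = 1` has a power that acts as a nontrivial power of `1 + X`, and the powers of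
`1 + X` are pairwise distinct, whence `w = 0` (`isUnit_deformation`). Hence `V((X))` is a
`Λ(G)_S`-module, and `Hom(P, V((X)))` and `Hom(Q, V((X)))` have the same dimension over `𝔽_p((X))`.
As `P` is projective, `Hom(P, V⟦X⟧)` is a finitely generated free `𝔽_p⟦X⟧`-module with generic fibre
`Hom(P, V((X)))` and special fibre `Hom(P, V)`, so its rank determines the number of homomorphisms
`P → V` (`card_hom_matrixModule_eq`).
-/

namespace NCIwasawa

noncomputable section

/-! ### Counting homomorphisms out of projective modules -/

section Counting

variable {R : Type u} [Ring R]

theorem finite_linearMap (P V : Type*) [AddCommGroup P] [Module R P] [Module.Finite R P]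
    [AddCommGroup V] [Module R V] [Finite V] : Finite (P →ₗ[R] V) := by
  obtain ⟨n, g, hg⟩ := Module.Finite.exists_fin' R P
  refine Finite.of_injective (fun f : P →ₗ[R] V => fun i => f (g (Pi.single i 1))) fun f f' h => ?_
  have : f ∘ₗ g = f' ∘ₗ g := (Pi.basisFun R (Fin n)).ext fun i => by simpa using congrFun h i
  exact LinearMap.ext fun x => by
    obtain ⟨y, rfl⟩ := hg x
    exact LinearMap.congr_fun this y

/-- `Hom(P, -)` is exact for projective `P`, so cardinalities multiply. -/
theorem card_linearMap_eq_mul (P V : Type*) [AddCommGroup P] [Module R P]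
    [Module.Projective R P] [AddCommGroup V] [Module R V] (N : Submodule R V) :
    Nat.card (P →ₗ[R] V) = Nat.card (P →ₗ[R] N) * Nat.card (P →ₗ[R] V ⧸ N) := by
  let φ : (P →ₗ[R] V) →+ (P →ₗ[R] V ⧸ N) :=
    { toFun := fun f => N.mkQ ∘ₗ f
      map_zero' := by ext; simp
      map_add' := fun f g => by ext; simp }
  have hφ : Function.Surjective φ := fun f =>
    Module.projective_lifting_property N.mkQ f N.mkQ_surjective
  let e : φ.ker ≃ (P →ₗ[R] N) :=
    { toFun := fun f => f.1.codRestrict N fun x => by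
        have := LinearMap.congr_fun (show N.mkQ ∘ₗ f.1 = 0 from f.2) x
        simpa using this
      invFun := fun f => ⟨N.subtype ∘ₗ f, by
        change N.mkQ ∘ₗ N.subtype ∘ₗ f = 0
        ext x; simp⟩
      left_inv := fun f => by ext; rfl
      right_inv := fun f => by ext; rfl }
  rw [AddSubgroup.card_eq_card_quotient_mul_card_addSubgroup φ.ker, Nat.card_congr e, mul_comm,
    Nat.card_congr (QuotientAddGroup.quotientKerEquivOfSurjective φ hφ).toEquiv]

/-- Every homomorphism is a surjection onto its range. -/
theorem card_linearMap_eq_sum (P V : Type*) [AddCommGroup P] [Module R P] [Module.Finite R P]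
    [AddCommGroup V] [Module R V] [Finite V] [Fintype (Submodule R V)] :
    Nat.card (P →ₗ[R] V) =
      ∑ W : Submodule R V, Nat.card {f : P →ₗ[R] W // Function.Surjective f} := by
  have (W : Submodule R V) : Finite (P →ₗ[R] W) := finite_linearMap P W
  rw [← Nat.card_sigma]
  refine (Nat.card_congr (Equiv.ofBijective
    (fun x : Σ W : Submodule R V, {f : P →ₗ[R] W // Function.Surjective f} =>
      x.1.subtype ∘ₗ x.2.1) ⟨?_, fun f => ?_⟩)).symm
  · have hr (W : Submodule R V) (f : P →ₗ[R] W) (hf : Function.Surjective f) :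
        LinearMap.range (W.subtype ∘ₗ f) = W := by
      rw [LinearMap.range_comp, LinearMap.range_eq_top.2 hf, Submodule.map_top, W.range_subtype]
    rintro ⟨W, f, hf⟩ ⟨W', f', hf'⟩ h
    dsimp only at h
    obtain rfl : W = W' := by rw [← hr W f hf, ← hr W' f' hf', h]
    obtain rfl : f = f' := LinearMap.ext fun x => Subtype.ext (LinearMap.congr_fun h x)
    rfl
  · exact ⟨⟨LinearMap.range f, f.rangeRestrict, f.surjective_rangeRestrict⟩, by ext; rfl⟩

/-- If `P` and `Q` have equally many homomorphisms to every finite module killed by `I`, then they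
have equally many surjections onto every such module: the homomorphisms onto proper submodules are
counted by induction. -/
theorem card_surjective_eq (I : Ideal R) (P Q : Type u) [AddCommGroup P] [Module R P]
    [Module.Finite R P] [AddCommGroup Q] [Module R Q] [Module.Finite R Q]
    (h : ∀ (V : Type u) [AddCommGroup V] [Module R V] [Finite V],
      (∀ r ∈ I, ∀ v : V, r • v = 0) → Nat.card (P →ₗ[R] V) = Nat.card (Q →ₗ[R] V))
    (V : Type u) [AddCommGroup V] [Module R V] [Finite V] (hV : ∀ r ∈ I, ∀ v : V, r • v = 0) :
    Nat.card {f : P →ₗ[R] V // Function.Surjective f} =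
      Nat.card {f : Q →ₗ[R] V // Function.Surjective f} := by
  induction hn : Nat.card V using Nat.strong_induction_on generalizing V with
  | _ n ih =>
    have : Finite (Submodule R V) := Finite.of_injective _ SetLike.coe_injective
    have := Fintype.ofFinite (Submodule R V)
    have key := h V hV
    classical
    rw [card_linearMap_eq_sum, card_linearMap_eq_sum, ← Finset.add_sum_erase _ _ (Finset.mem_univ ⊤),
      ← Finset.add_sum_erase _ _ (Finset.mem_univ (⊤ : Submodule R V)),
      Finset.sum_congr rfl fun (W : Submodule R V) hW => ih (Nat.card W) ?_ W
        (fun r hr w => Subtype.ext (hV r hr w)) rfl] at key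
    · have top (M : Type u) [AddCommGroup M] [Module R M] :
          Nat.card {f : M →ₗ[R] (⊤ : Submodule R V) // Function.Surjective f} =
            Nat.card {f : M →ₗ[R] V // Function.Surjective f} :=
        Nat.card_congr
          { toFun := fun f =>
              ⟨Submodule.topEquiv.toLinearMap ∘ₗ f.1, Submodule.topEquiv.surjective.comp f.2⟩
            invFun := fun f => ⟨Submodule.topEquiv.symm.toLinearMap ∘ₗ f.1,
              Submodule.topEquiv.symm.surjective.comp f.2⟩
            left_inv := fun f => rfl
            right_inv := fun f => rfl }
      rw [top, top] at key
      exact Nat.add_right_cancel key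
    · rw [← hn]
      have hW' : (W : Set V) ≠ Set.univ := fun h =>
        Finset.ne_of_mem_erase hW (SetLike.coe_injective h)
      have := Set.ncard_lt_ncard ((Set.ssubset_univ_iff).2 hW')
      rwa [Set.ncard_univ] at this

/-- A finitely generated module modulo a left ideal of finite index is finite. -/
theorem finite_quotient_smul_top (I : Ideal R) [Finite (R ⧸ I)] (P : Type*) [AddCommGroup P]
    [Module R P] [Module.Finite R P] : Finite (P ⧸ (I • ⊤ : Submodule R P)) := by
  obtain ⟨n, g, hg⟩ := Module.Finite.exists_fin' R P
  refine Finite.of_surjective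
    (fun c : Fin n → R ⧸ I => (I • ⊤ : Submodule R P).mkQ (g fun i => (c i).out)) fun y => ?_
  obtain ⟨y, rfl⟩ := Submodule.mkQ_surjective _ y
  obtain ⟨w, rfl⟩ := hg y
  refine ⟨fun i => Submodule.Quotient.mk (w i), ?_⟩
  rw [← sub_eq_zero, ← map_sub, ← map_sub, Submodule.mkQ_apply, Submodule.Quotient.mk_eq_zero,
    ← Finset.univ_sum_single ((fun i => (Submodule.Quotient.mk (w i) : R ⧸ I).out) - w), map_sum]
  refine Submodule.sum_mem _ fun i _ => ?_
  have : (Pi.single i (((fun i => (Submodule.Quotient.mk (w i) : R ⧸ I).out) - w) i) :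
      Fin n → R) = ((Submodule.Quotient.mk (w i) : R ⧸ I).out - w i) • Pi.single i (1 : R) := by
    rw [← Pi.single_smul', smul_eq_mul, mul_one]
    rfl
  rw [this, map_smul]
  refine Submodule.smul_mem_smul ?_ trivial
  rw [← Submodule.Quotient.mk_eq_zero, Submodule.Quotient.mk_sub, Submodule.Quotient.mk_out,
    sub_self]

theorem smul_quotient_smul_top (I : Ideal R) (P : Type*) [AddCommGroup P] [Module R P]
    (r : R) (hr : r ∈ I) (v : P ⧸ (I • ⊤ : Submodule R P)) : r • v = 0 := by
  obtain ⟨v, rfl⟩ := Submodule.mkQ_surjective _ v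
  rw [← map_smul, Submodule.mkQ_apply, Submodule.Quotient.mk_eq_zero]
  exact Submodule.smul_mem_smul hr trivial

/-- If `P` and `Q` have equally many homomorphisms to every finite module killed by `I`, then
`P ≅ Q` modulo `I`. Since `P` and `Q` are projective, the isomorphism and its inverse lift. -/
theorem exists_equiv_mod (I : Ideal R) [Finite (R ⧸ I)] (P Q : Type u) [AddCommGroup P]
    [Module R P] [Module.Finite R P] [Module.Projective R P] [AddCommGroup Q] [Module R Q]
    [Module.Finite R Q] [Module.Projective R Q]
    (h : ∀ (V : Type u) [AddCommGroup V] [Module R V] [Finite V],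
      (∀ r ∈ I, ∀ v : V, r • v = 0) → Nat.card (P →ₗ[R] V) = Nat.card (Q →ₗ[R] V)) :
    ∃ (a : P →ₗ[R] Q) (b : Q →ₗ[R] P), (∀ x, b (a x) - x ∈ (I • ⊤ : Submodule R P)) ∧
      ∀ y, a (b y) - y ∈ (I • ⊤ : Submodule R Q) := by
  have := finite_quotient_smul_top I P
  have := finite_quotient_smul_top I Q
  set IP : Submodule R P := I • ⊤
  set IQ : Submodule R Q := I • ⊤
  have surj (A B : Type u) [AddCommGroup A] [Module R A] [Module.Finite R A] [AddCommGroup B]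
      [Module R B] [Module.Finite R B] [Finite (A ⧸ (I • ⊤ : Submodule R A))]
      (hAB : ∀ (V : Type u) [AddCommGroup V] [Module R V] [Finite V],
        (∀ r ∈ I, ∀ v : V, r • v = 0) → Nat.card (B →ₗ[R] V) = Nat.card (A →ₗ[R] V)) :
      ∃ f : (B ⧸ (I • ⊤ : Submodule R B)) →ₗ[R] (A ⧸ (I • ⊤ : Submodule R A)),
        Function.Surjective f := by
    have hc := card_surjective_eq I B A hAB (A ⧸ (I • ⊤ : Submodule R A))
      (smul_quotient_smul_top I A)
    have : Finite (B →ₗ[R] (A ⧸ (I • ⊤ : Submodule R A))) := finite_linearMap _ _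
    have : Finite (A →ₗ[R] (A ⧸ (I • ⊤ : Submodule R A))) := finite_linearMap _ _
    have hpos : 0 < Nat.card
        {f : A →ₗ[R] (A ⧸ (I • ⊤ : Submodule R A)) // Function.Surjective f} :=
      Nat.card_pos_iff.2 ⟨⟨⟨_, Submodule.mkQ_surjective _⟩⟩, inferInstance⟩
    rw [← hc, Nat.card_pos_iff] at hpos
    obtain ⟨⟨f, hf⟩⟩ := hpos.1
    have hle : (I • ⊤ : Submodule R B) ≤ LinearMap.ker f := Submodule.smul_le.2 fun r hr x _ => by
      rw [LinearMap.mem_ker, map_smul, smul_quotient_smul_top I A r hr]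
    refine ⟨Submodule.liftQ _ f hle, fun y => ?_⟩
    obtain ⟨x, rfl⟩ := hf y
    exact ⟨Submodule.Quotient.mk x, by simp⟩
  -- The finite modules `P/IP` and `Q/IQ` surject onto each other, so the surjections are bijective.
  obtain ⟨f, hf⟩ := surj Q P h
  obtain ⟨g, hg⟩ := surj P Q fun V _ _ _ hV => (h V hV).symm
  have hbij : Function.Bijective f := hf.bijective_of_nat_card_le
    (Nat.card_le_card_of_surjective g hg)
  let e : (P ⧸ IP) ≃ₗ[R] (Q ⧸ IQ) := LinearEquiv.ofBijective f hbij
  obtain ⟨a, ha⟩ := Module.projective_lifting_property IQ.mkQ (e.toLinearMap ∘ₗ IP.mkQ)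
    IQ.mkQ_surjective
  obtain ⟨b, hb⟩ := Module.projective_lifting_property IP.mkQ (e.symm.toLinearMap ∘ₗ IQ.mkQ)
    IP.mkQ_surjective
  have ha' (x : P) : IQ.mkQ (a x) = e (IP.mkQ x) := LinearMap.congr_fun ha x
  have hb' (x : Q) : IP.mkQ (b x) = e.symm (IQ.mkQ x) := LinearMap.congr_fun hb x
  refine ⟨a, b, fun x => ?_, fun y => ?_⟩
  · rw [← Submodule.Quotient.mk_eq_zero, ← Submodule.mkQ_apply, map_sub, hb', ha',
      LinearEquiv.symm_apply_apply, sub_self]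
  · rw [← Submodule.Quotient.mk_eq_zero, ← Submodule.mkQ_apply, map_sub, ha', hb',
      LinearEquiv.apply_symm_apply, sub_self]

end Counting

/-! ### Projective modules over compact rings -/

section Compact

variable {R : Type u} [Ring R]

theorem apply_mem_of_mem_smul_top (I : Ideal R) [I.IsTwoSided] {P : Type*} [AddCommGroup P]
    [Module R P] {m : ℕ} (f : P →ₗ[R] (Fin m → R)) {x : P} (hx : x ∈ (I • ⊤ : Submodule R P))
    (l : Fin m) : f x l ∈ I := by
  induction hx using Submodule.smul_induction_on' with
  | smul r hr n hn =>
    rw [map_smul, Pi.smul_apply, smul_eq_mul]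
    exact I.mul_mem_right _ hr
  | add x hx y hy h1 h2 => rw [map_add]; exact I.add_mem h1 h2

/-- Over a compact topological ring, finitely generated projective modules that are isomorphic
modulo every member of a directed family of closed two-sided ideals with zero intersection are
isomorphic. The pairs of matrices that represent mutually inverse isomorphisms modulo a given
ideal form a nonempty compact set. -/
theorem nonempty_linearEquiv_of_mod [TopologicalSpace R] [IsTopologicalRing R] [CompactSpace R]
    {J : Type*} [Nonempty J] (I : J → Ideal R) [∀ j, (I j).IsTwoSided]
    (hclosed : ∀ j, IsClosed (I j : Set R)) (hdir : Directed (· ≥ ·) I)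
    (hinf : ∀ r, (∀ j, r ∈ I j) → r = 0)
    (P Q : Type*) [AddCommGroup P] [Module R P] [Module.Finite R P] [Module.Projective R P]
    [AddCommGroup Q] [Module R Q] [Module.Finite R Q] [Module.Projective R Q]
    (h : ∀ j, ∃ (a : P →ₗ[R] Q) (b : Q →ₗ[R] P),
      (∀ x, b (a x) - x ∈ (I j • ⊤ : Submodule R P)) ∧
      ∀ y, a (b y) - y ∈ (I j • ⊤ : Submodule R Q)) : Nonempty (P ≃ₗ[R] Q) := by
  obtain ⟨m, r, hr⟩ := Module.Finite.exists_fin' R P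
  obtain ⟨i, hi⟩ := Module.projective_lifting_property r LinearMap.id hr
  obtain ⟨n, t, ht⟩ := Module.Finite.exists_fin' R Q
  obtain ⟨j, hj⟩ := Module.projective_lifting_property t LinearMap.id ht
  have hi' (x : P) : r (i x) = x := LinearMap.congr_fun hi x
  have hj' (x : Q) : t (j x) = x := LinearMap.congr_fun hj x
  -- `P` and `Q` are direct summands of free modules, so matrices parametrise all homomorphisms.
  let A (α : Fin m → Fin n → R) : P →ₗ[R] Q := t ∘ₗ Fintype.linearCombination R α ∘ₗ i
  let B (β : Fin n → Fin m → R) : Q →ₗ[R] P := r ∘ₗ Fintype.linearCombination R β ∘ₗ j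
  have hA (a : P →ₗ[R] Q) : A (fun k => j (a (r (Pi.single k 1)))) = a := by
    have : Fintype.linearCombination R (fun k => j (a (r (Pi.single k 1)))) = j ∘ₗ a ∘ₗ r :=
      (Pi.basisFun R (Fin m)).ext fun k => by simp
    ext x
    simp [A, this, hi', hj']
  have hB (b : Q →ₗ[R] P) : B (fun k => i (b (t (Pi.single k 1)))) = b := by
    have : Fintype.linearCombination R (fun k => i (b (t (Pi.single k 1)))) = i ∘ₗ b ∘ₗ t :=
      (Pi.basisFun R (Fin n)).ext fun k => by simp
    ext x
    simp [B, this, hi', hj']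
  have hcomb (m n : ℕ) : Continuous fun x : (Fin m → R) × (Fin m → Fin n → R) =>
      Fintype.linearCombination R x.2 x.1 := by
    simp only [Fintype.linearCombination_apply]
    fun_prop
  have hlin (m n : ℕ) (f : (Fin m → R) →ₗ[R] (Fin n → R)) : Continuous f :=
    LinearMap.continuous_on_pi f
  -- The pairs of matrices whose homomorphisms are mutually inverse modulo `I`, tested on generators.
  let C (I : Ideal R) : Set ((Fin m → Fin n → R) × (Fin n → Fin m → R)) :=
    {x | (∀ k l, (i (B x.2 (A x.1 (r (Pi.single k 1)))) - i (r (Pi.single k 1))) l ∈ I) ∧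
      ∀ k l, (j (A x.1 (B x.2 (t (Pi.single k 1)))) - j (t (Pi.single k 1))) l ∈ I}
  have hC (k : J) : IsClosed (C (I k)) := by
    have hA' (x : P) : Continuous fun z : (Fin m → Fin n → R) × (Fin n → Fin m → R) =>
        i (B z.2 (A z.1 x)) :=
      (hlin _ _ (i ∘ₗ r)).comp ((hcomb n m).comp (((hlin _ _ (j ∘ₗ t)).comp
        ((hcomb m n).comp (continuous_const.prodMk continuous_fst))).prodMk continuous_snd))
    have hB' (y : Q) : Continuous fun z : (Fin m → Fin n → R) × (Fin n → Fin m → R) =>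
        j (A z.1 (B z.2 y)) :=
      (hlin _ _ (j ∘ₗ t)).comp ((hcomb m n).comp (((hlin _ _ (i ∘ₗ r)).comp
        ((hcomb n m).comp (continuous_const.prodMk continuous_snd))).prodMk continuous_fst))
    simp only [C, Set.ofPred_and, Set.ofPred_forall]
    refine IsClosed.inter (isClosed_iInter fun a => isClosed_iInter fun l => ?_)
      (isClosed_iInter fun a => isClosed_iInter fun l => ?_)
    · exact (hclosed k).preimage ((continuous_apply l).comp ((hA' _).sub continuous_const))
    · exact (hclosed k).preimage ((continuous_apply l).comp ((hB' _).sub continuous_const))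
  obtain ⟨⟨α, β⟩, hz⟩ := IsCompact.nonempty_iInter_of_directed_nonempty_isCompact_isClosed
    (fun k => C (I k))
    (fun a b => by
      obtain ⟨c, hca, hcb⟩ := hdir a b
      exact ⟨c, fun x hx => ⟨fun k l => hca (hx.1 k l), fun k l => hca (hx.2 k l)⟩,
        fun x hx => ⟨fun k l => hcb (hx.1 k l), fun k l => hcb (hx.2 k l)⟩⟩)
    (fun k => by
      obtain ⟨a, b, hab, hba⟩ := h k
      refine ⟨(fun l => j (a (r (Pi.single l 1))), fun l => i (b (t (Pi.single l 1)))),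
        fun l s => ?_, fun l s => ?_⟩
      · dsimp only
        rw [hA, hB, ← map_sub]
        exact apply_mem_of_mem_smul_top _ i (hab _) s
      · dsimp only
        rw [hA, hB, ← map_sub]
        exact apply_mem_of_mem_smul_top _ j (hba _) s)
    (fun k => (hC k).isCompact) hC
  rw [Set.mem_iInter] at hz
  have h1 : i ∘ₗ B β ∘ₗ A α ∘ₗ r = i ∘ₗ r := (Pi.basisFun R (Fin m)).ext fun k => by
    ext l
    simpa [sub_eq_zero] using hinf _ fun s => (hz s).1 k l
  have h2 : j ∘ₗ A α ∘ₗ B β ∘ₗ t = j ∘ₗ t := (Pi.basisFun R (Fin n)).ext fun k => by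
    ext l
    simpa [sub_eq_zero] using hinf _ fun s => (hz s).2 k l
  refine ⟨LinearEquiv.ofLinearMap (A α) (B β) (LinearMap.ext fun y => ?_)
    (LinearMap.ext fun x => ?_)⟩
  · have := congrArg t (LinearMap.congr_fun h2 (j y))
    simpa [hj'] using this
  · have := congrArg r (LinearMap.congr_fun h1 (i x))
    simpa [hi'] using this

end Compact

/-! ### The localisation sequence -/

section Relative

variable {R R' : Type u} [Ring R] [Ring R'] (f : R →+* R')

/-- Extension of scalars preserves finitely generated projective modules. -/
def FGProj.baseChange (P : FGProj R) : FGProj R' :=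
  haveI key : ∃ (n : ℕ) (r : (Fin n → R') →ₗ[R'] BaseChange f P)
      (i : BaseChange f P →ₗ[R'] (Fin n → R')), r ∘ₗ i = LinearMap.id := by
    obtain ⟨n, r, hr⟩ := Module.Finite.exists_fin' R P
    obtain ⟨i, hi⟩ := Module.projective_lifting_property r LinearMap.id hr
    refine ⟨n, BaseChange.map f r ∘ₗ (BaseChange.freeEquiv f n).symm.toLinearMap,
      (BaseChange.freeEquiv f n).toLinearMap ∘ₗ BaseChange.map f i, BaseChange.hom_ext fun x => ?_⟩
    have : r (i x) = x := LinearMap.congr_fun hi x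
    simp [this]
  haveI : Module.Finite R' (BaseChange f P) := by
    obtain ⟨n, r, i, h⟩ := key
    exact Module.Finite.of_surjective r fun x => ⟨i x, LinearMap.congr_fun h x⟩
  haveI : Module.Projective R' (BaseChange f P) := by
    obtain ⟨n, r, i, h⟩ := key
    exact Module.Projective.of_split i r h
  { carrier := BaseChange f P }

theorem K0Relative.ofAut_mem_range (P : FGProj R) (α : BaseChange f P ≃ₗ[R'] BaseChange f P) :
    ofAut f P α ∈ (boundary f).range := by
  let X : Presentation f (P.baseChange f) :=
    { base := P
      compl := FGProj.free R' 0
      equiv := (LinearEquiv.prodUnique (R := R') (M := BaseChange f P)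
        (M₂ := Fin 0 → R')).symm }
  refine ⟨K1.mk (P.baseChange f) α, (boundary_mk f X α).trans ?_⟩
  change ofAut f P _ = _
  congr 1

/-- If modules that become isomorphic over `R'` are already isomorphic over `R`, then `∂` is
surjective: `(P, α, Q)` is isomorphic to a triple `(P, β, P)`. -/
theorem boundary_surjective_of_nonempty_linearEquiv
    (h : ∀ P Q : FGProj R, (BaseChange f P ≃ₗ[R'] BaseChange f Q) → Nonempty (P ≃ₗ[R] Q)) :
    Function.Surjective (boundary f) := by
  rw [← AddMonoidHom.range_eq_top, eq_top_iff]
  rintro x -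
  obtain ⟨x, rfl⟩ := QuotientAddGroup.mk'_surjective _ x
  induction x using FreeAbelianGroup.induction_on with
  | zero => rw [map_zero]; exact zero_mem _
  | of X =>
    obtain ⟨P, Q, α⟩ := X
    obtain ⟨g⟩ := h P Q α
    let γ : BaseChange f Q ≃ₗ[R'] BaseChange f P := LinearEquiv.ofLinearMap
      (BaseChange.map f g.symm.toLinearMap) (BaseChange.map f g.toLinearMap)
      (BaseChange.hom_ext fun x => by simp) (BaseChange.hom_ext fun x => by simp)
    have hX : K0Relative.mk f ⟨P, Q, α⟩ = K0Relative.ofAut f P (α.trans γ) := by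
      rw [← sub_eq_zero, K0Relative.ofAut, K0Relative.mk, K0Relative.mk, ← map_sub]
      exact (QuotientAddGroup.eq_zero_iff _).2 (AddSubgroup.subset_closure
        (K0RelativeRel.iso ⟨P, Q, α⟩ ⟨P, P, α.trans γ⟩ (LinearEquiv.refl R P) g.symm fun x => by
          have : BaseChange.map f (LinearEquiv.refl R P).toLinearMap = LinearMap.id :=
            BaseChange.hom_ext fun x => by simp
          rw [this]
          rfl))
    exact (congrArg (· ∈ (boundary f).range) hX).mpr (K0Relative.ofAut_mem_range f P _)
  | neg X hX => rw [map_neg]; exact neg_mem hX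
  | add x y hx hy => rw [map_add]; exact add_mem hx hy

theorem eta_eq_zero_of_nonempty_linearEquiv
    (h : ∀ P Q : FGProj R, (BaseChange f P ≃ₗ[R'] BaseChange f Q) → Nonempty (P ≃ₗ[R] Q)) :
    eta f = 0 := by
  refine QuotientAddGroup.addMonoidHom_ext _ (FreeAbelianGroup.lift_ext _ _ fun X => ?_)
  obtain ⟨g⟩ := h X.dom X.cod X.iso
  exact (eta_mk f X).trans (sub_eq_zero.2 (K0.mk_eq_of_equiv g))

end Relative

/-! ### The Iwasawa algebra as a compact ring -/

section Topology

variable (p : ℕ) [Fact p.Prime] {G : Type u} [Group G] [TopologicalSpace G]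

/-- The projection `Λ(G) → ℤ_p[G/U]`. -/
def lambdaProj (U : OpenNormalSubgroup G) :
    Lambda p G →+* MonoidAlgebra ℤ_[p] (G ⧸ U.toSubgroup) where
  toFun x := x.1 U
  map_one' := rfl
  map_mul' _ _ := rfl
  map_zero' := rfl
  map_add' _ _ := rfl

theorem transition_lambdaProj {U V : OpenNormalSubgroup G} (h : U ≤ V) (x : Lambda p G) :
    transition p U V h (lambdaProj p U x) = lambdaProj p V x :=
  x.2 U V h

/-- The coefficients of an element of `Λ(G)` at all finite levels. -/
def lambdaCoeff (x : Lambda p G) (U : OpenNormalSubgroup G) (q : G ⧸ U.toSubgroup) : ℤ_[p] :=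
  (lambdaProj p U x).coeff q

variable {p} in
theorem lambda_ext {x y : Lambda p G} (h : ∀ U, lambdaProj p U x = lambdaProj p U y) : x = y :=
  Subtype.ext (funext h)

theorem lambdaCoeff_injective : Function.Injective (lambdaCoeff p (G := G)) := fun _ _ h =>
  lambda_ext fun U => MonoidAlgebra.ext <| Finsupp.ext fun q => congrFun (congrFun h U) q

/-- The profinite topology of `Λ(G)`: the topology of convergence of all coefficients at all
finite levels. -/
instance : TopologicalSpace (Lambda p G) :=
  TopologicalSpace.induced (lambdaCoeff p) inferInstance

theorem continuous_lambdaCoeff (U : OpenNormalSubgroup G) (q : G ⧸ U.toSubgroup) :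
    Continuous fun x : Lambda p G => lambdaCoeff p x U q :=
  have h : Continuous (lambdaCoeff p (G := G)) := continuous_induced_dom
  (continuous_apply q).comp ((continuous_apply U).comp h)

theorem continuous_lambda_iff {X : Type*} [TopologicalSpace X] {f : X → Lambda p G} :
    Continuous f ↔ ∀ U q, Continuous fun x => lambdaCoeff p (f x) U q := by
  rw [continuous_induced_rng, continuous_pi_iff]
  simp only [continuous_pi_iff, Function.comp_apply]

/-- The reduction `Λ(G) → (ℤ/pⁿ)[G/U]`. -/
def lambdaReduction (U : OpenNormalSubgroup G) (n : ℕ) :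
    Lambda p G →+* MonoidAlgebra (ZMod (p ^ n)) (G ⧸ U.toSubgroup) :=
  (MonoidAlgebra.mapRingHom _ (PadicInt.toZModPow n)).comp (lambdaProj p U)

theorem mem_ker_lambdaReduction {U : OpenNormalSubgroup G} {n : ℕ} {x : Lambda p G} :
    x ∈ RingHom.ker (lambdaReduction p U n) ↔
      ∀ q, PadicInt.toZModPow n (lambdaCoeff p x U q) = 0 := by
  rw [RingHom.mem_ker, MonoidAlgebra.ext_iff, Finsupp.ext_iff]
  exact forall_congr' fun q => by
    rw [lambdaReduction, RingHom.comp_apply, MonoidAlgebra.coeff_mapRingHom]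
    rfl

theorem isClosed_ker_lambdaReduction (U : OpenNormalSubgroup G) (n : ℕ) :
    IsClosed (RingHom.ker (lambdaReduction p U n) : Set (Lambda p G)) := by
  have : (RingHom.ker (lambdaReduction p U n) : Set (Lambda p G)) =
      ⋂ q, {x | ‖lambdaCoeff p x U q‖ ≤ (p : ℝ) ^ (-n : ℤ)} := by
    ext x
    rw [SetLike.mem_coe, mem_ker_lambdaReduction]
    simp only [Set.mem_iInter, Set.mem_ofPred_eq,
      PadicInt.norm_le_pow_iff_mem_span_pow, ← PadicInt.ker_toZModPow, RingHom.mem_ker]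
  rw [this]
  exact isClosed_iInter fun q => isClosed_le (continuous_lambdaCoeff p U q).norm continuous_const

theorem ker_lambdaReduction_mono {U V : OpenNormalSubgroup G} (h : U ≤ V) {m n : ℕ} (hmn : m ≤ n) :
    RingHom.ker (lambdaReduction p U n) ≤ RingHom.ker (lambdaReduction p V m) := by
  intro x hx
  have hx' : lambdaReduction p U m x = 0 := by
    rw [← RingHom.mem_ker, mem_ker_lambdaReduction]
    intro q
    rw [← PadicInt.cast_toZModPow m n hmn, (mem_ker_lambdaReduction p).1 hx q, ZMod.cast_zero]
  rw [RingHom.mem_ker, lambdaReduction, RingHom.comp_apply, ← transition_lambdaProj p h,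
    transition, ← RingHom.comp_apply, MonoidAlgebra.mapRingHom_comp_mapDomainRingHom,
    RingHom.comp_apply]
  exact (congrArg _ hx').trans (map_zero _)

variable [IsTopologicalGroup G] [CompactSpace G]

instance (U : OpenNormalSubgroup G) : Finite (G ⧸ U.toSubgroup) :=
  U.toSubgroup.quotient_finite_of_isOpen U.isOpen

instance : IsTopologicalRing (Lambda p G) where
  continuous_add := (continuous_lambda_iff p).2 fun U q => by
    have h (x : Lambda p G × Lambda p G) : lambdaCoeff p (x.1 + x.2) U q =
        lambdaCoeff p x.1 U q + lambdaCoeff p x.2 U q := by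
      simp [lambdaCoeff]
    simp only [h]
    exact ((continuous_lambdaCoeff p U q).comp continuous_fst).add
      ((continuous_lambdaCoeff p U q).comp continuous_snd)
  continuous_mul := (continuous_lambda_iff p).2 fun U q => by
    have := Fintype.ofFinite (G ⧸ U.toSubgroup)
    have h (x : Lambda p G × Lambda p G) : lambdaCoeff p (x.1 * x.2) U q =
        ∑ r, lambdaCoeff p x.1 U r * lambdaCoeff p x.2 U (r⁻¹ * q) := by
      simp only [lambdaCoeff, map_mul]
      rw [MonoidAlgebra.coeff_mul_apply_left, Finsupp.sum_fintype _ _ fun _ => zero_mul _]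
    simp only [h]
    exact continuous_finsetSum _ fun r _ =>
      ((continuous_lambdaCoeff p U _).comp continuous_fst).mul
        ((continuous_lambdaCoeff p U _).comp continuous_snd)
  continuous_neg := (continuous_lambda_iff p).2 fun U q => by
    have h (x : Lambda p G) : lambdaCoeff p (-x) U q = -lambdaCoeff p x U q := by
      simp [lambdaCoeff]
    simp only [h]
    exact (continuous_lambdaCoeff p U q).neg

instance : CompactSpace (Lambda p G) := by
  have e : Topology.IsInducing (lambdaCoeff p (G := G)) := ⟨rfl⟩
  let c (U : OpenNormalSubgroup G) :
      (G ⧸ U.toSubgroup → ℤ_[p]) ≃ₗ[ℤ_[p]] MonoidAlgebra ℤ_[p] (G ⧸ U.toSubgroup) :=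
    (Finsupp.linearEquivFunOnFinite ℤ_[p] ℤ_[p] (G ⧸ U.toSubgroup)).symm.trans
      (MonoidAlgebra.coeffLinearEquiv ℤ_[p]).symm
  -- The compatibility conditions that cut the image of `Λ(G)` out of the compact product are
  -- closed: each is an equation between `ℤ_p`-linear forms in finitely many coefficients.
  let d (U V : OpenNormalSubgroup G) (h : U ≤ V) (q : G ⧸ V.toSubgroup) :
      (G ⧸ U.toSubgroup → ℤ_[p]) →ₗ[ℤ_[p]] ℤ_[p] :=
    { toFun := fun y => (transition p U V h (c U y)).coeff q
      map_add' := fun y z => by simp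
      map_smul' := fun a y => by
        rw [map_smul, transition, MonoidAlgebra.mapDomainRingHom_apply,
          MonoidAlgebra.mapDomain_smul]
        simp }
  have hrange : Set.range (lambdaCoeff p (G := G)) =
      ⋂ (U) (V) (h : U ≤ V) (q), {y | d U V h q (y U) = y V q} := by
    ext y
    simp only [Set.mem_iInter, Set.mem_ofPred_eq]
    constructor
    · rintro ⟨x, rfl⟩ U V h q
      have hx : c U (lambdaCoeff p x U) = lambdaProj p U x := MonoidAlgebra.ext <| Finsupp.ext fun q => rfl
      change (transition p U V h (c U (lambdaCoeff p x U))).coeff q = _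
      rw [hx, transition_lambdaProj]
      rfl
    · intro hy
      exact ⟨⟨fun U => c U (y U), fun U V h => MonoidAlgebra.ext <| Finsupp.ext fun q => hy U V h q⟩, rfl⟩
  have hclosed : IsClosed (Set.range (lambdaCoeff p (G := G))) := by
    rw [hrange]
    refine isClosed_iInter fun U => isClosed_iInter fun V => isClosed_iInter fun h =>
      isClosed_iInter fun q => isClosed_eq ?_ ?_
    · exact (LinearMap.continuous_on_pi (d U V h q)).comp (continuous_apply U)
    · exact (continuous_apply q).comp (continuous_apply V)
  exact (Topology.IsClosedEmbedding.mk ⟨e, lambdaCoeff_injective p⟩ hclosed).compactSpace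

instance finite_quotient_ker_lambdaReduction (U : OpenNormalSubgroup G) (n : ℕ) :
    Finite (Lambda p G ⧸ RingHom.ker (lambdaReduction p U n)) := by
  have : NeZero (p ^ n) := ⟨pow_ne_zero _ (Fact.out : p.Prime).ne_zero⟩
  have : Finite (MonoidAlgebra (ZMod (p ^ n)) (G ⧸ U.toSubgroup)) :=
    Finite.of_equiv _ (Finsupp.equivFunOnFinite.symm.trans MonoidAlgebra.coeffEquiv.symm)
  exact Finite.of_injective _ (RingHom.kerLift_injective (lambdaReduction p U n))

/-- Finitely generated projective `Λ(G)`-modules with equally many homomorphisms to every finite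
`ℤ/p`-module with an action of a finite quotient of `G` are isomorphic. -/
theorem nonempty_linearEquiv_of_card_eq (P Q : Type u) [AddCommGroup P]
    [Module (Lambda p G) P] [Module.Finite (Lambda p G) P] [Module.Projective (Lambda p G) P]
    [AddCommGroup Q] [Module (Lambda p G) Q] [Module.Finite (Lambda p G) Q]
    [Module.Projective (Lambda p G) Q]
    (h : ∀ (V : Type u) [AddCommGroup V] [Module (Lambda p G) V] [Finite V]
      (U : OpenNormalSubgroup G), (∀ r, lambdaProj p U r = 0 → ∀ v : V, r • v = 0) →
      (∀ v : V, (p : Lambda p G) • v = 0) →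
      Nat.card (P →ₗ[Lambda p G] V) = Nat.card (Q →ₗ[Lambda p G] V)) :
    Nonempty (P ≃ₗ[Lambda p G] Q) := by
  -- Modules killed by `pⁿ` are reduced to modules killed by `p` by the exact sequence
  -- `0 → pV → V → V/pV → 0`.
  have main (n : ℕ) : ∀ (V : Type u) [AddCommGroup V] [Module (Lambda p G) V] [Finite V]
      (U : OpenNormalSubgroup G), (∀ r, lambdaProj p U r = 0 → ∀ v : V, r • v = 0) →
      (∀ v : V, (p ^ n : Lambda p G) • v = 0) →
      Nat.card (P →ₗ[Lambda p G] V) = Nat.card (Q →ₗ[Lambda p G] V) := by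
    induction n with
    | zero =>
      intro V _ _ _ U _ hV
      have : Subsingleton V := ⟨fun v w => by
        rw [← one_smul (Lambda p G) v, ← one_smul (Lambda p G) w, ← pow_zero (p : Lambda p G),
          hV, hV]⟩
      simp
    | succ n ih =>
      intro V _ _ _ U hU hV
      let N : Submodule (Lambda p G) V := LinearMap.range (p • LinearMap.id : V →ₗ[Lambda p G] V)
      have hN (v : V) : (p : Lambda p G) • v ∈ N := ⟨v, by simp [Nat.cast_smul_eq_nsmul]⟩
      have : Finite (V ⧸ N) := Finite.of_surjective _ N.mkQ_surjective
      rw [card_linearMap_eq_mul P V N, card_linearMap_eq_mul Q V N,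
        ih N U (fun r hr v => Subtype.ext (hU r hr v)), h (V ⧸ N) U]
      · rintro r hr ⟨v⟩
        exact congrArg N.mkQ (hU r hr v)
      · rintro ⟨v⟩
        exact (Submodule.Quotient.mk_eq_zero N).2 (hN v)
      · rintro ⟨_, v, rfl⟩
        refine Subtype.ext (Eq.trans ?_ (hV v))
        simp [pow_succ, mul_smul, Nat.cast_smul_eq_nsmul]
  have : Nonempty (OpenNormalSubgroup G) := ⟨⟨⊤, (inferInstance : (⊤ : Subgroup G).Normal)⟩⟩
  refine nonempty_linearEquiv_of_mod (J := OpenNormalSubgroup G × ℕ)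
    (fun j => RingHom.ker (lambdaReduction p j.1 j.2))
    (fun j => isClosed_ker_lambdaReduction p _ _) (fun a b => ⟨(a.1 ⊓ b.1, max a.2 b.2),
      ker_lambdaReduction_mono p inf_le_left (le_max_left _ _),
      ker_lambdaReduction_mono p inf_le_right (le_max_right _ _)⟩) (fun r hr => ?_) P Q fun j => ?_
  · refine lambdaCoeff_injective p (funext fun U => funext fun q => ?_)
    refine PadicInt.ext_of_toZModPow.1 fun n => ?_
    rw [(mem_ker_lambdaReduction p).1 (hr (U, n)) q]
    simp [lambdaCoeff]
  · refine exists_equiv_mod _ P Q fun V _ _ _ hV => main j.2 V j.1 (fun r hr => hV r ?_) (hV _ ?_)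
    · rw [RingHom.mem_ker, lambdaReduction, RingHom.comp_apply, hr, map_zero]
    · rw [RingHom.mem_ker, map_pow, map_natCast, ← Nat.cast_pow,
        ← map_natCast (algebraMap (ZMod (p ^ j.2)) _), ZMod.natCast_self, map_zero]

end Topology

/-! ### Deforming a finite module along the cyclotomic character -/

section Deformation

open PowerSeries

variable (p : ℕ) [Fact p.Prime]

/-- The character `z ↦ (1 + X)ᶻ` of `ℤ_p` with values in `𝔽_p⟦X⟧`. -/
def onePlusXPow : Multiplicative ℤ_[p] →* (ZMod p)⟦X⟧ where
  toFun z := PowerSeries.map PadicInt.toZMod (binomialSeries ℤ_[p] z.toAdd)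
  map_one' := by simp
  map_mul' z w := by simp

theorem onePlusXPow_natCast (n : ℕ) :
    onePlusXPow p (Multiplicative.ofAdd (n : ℤ_[p])) = (1 + X) ^ n := by
  simp [onePlusXPow]

theorem X_dvd_onePlusXPow_sub_one (z : Multiplicative ℤ_[p]) :
    X ∣ onePlusXPow p z - 1 := by
  rw [X_dvd_iff, map_sub, map_one, ← coeff_zero_eq_constantCoeff_apply]
  simp [onePlusXPow]

/-- Since `(1 + X) ^ (pᵏ z) = (1 + ⋯) ^ pᵏ`, the character is trivial modulo `X ^ pᵏ` on
`pᵏ ℤ_p`. -/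
theorem X_pow_dvd_onePlusXPow_sub_one (k : ℕ) (z : Multiplicative ℤ_[p])
    (hz : PadicInt.toZModPow k z.toAdd = 0) : X ^ (k + 1) ∣ onePlusXPow p z - 1 := by
  rw [← RingHom.mem_ker, PadicInt.ker_toZModPow, Ideal.mem_span_singleton] at hz
  obtain ⟨w, hw⟩ := hz
  have hz' : z = Multiplicative.ofAdd w ^ p ^ k := by
    rw [← ofAdd_nsmul, nsmul_eq_mul, Nat.cast_pow, ← hw, ofAdd_toAdd]
  have : CharP (ZMod p)⟦X⟧ p := charP_of_injective_ringHom (C_injective (R := ZMod p)) p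
  have h := sub_pow_char_pow (p := p) (n := k) (onePlusXPow p (Multiplicative.ofAdd w)) 1
  rw [hz', map_pow]
  rw [one_pow] at h
  rw [← h]
  exact (pow_dvd_pow X (Nat.lt_pow_self (Fact.out : p.Prime).one_lt)).trans
    (pow_dvd_pow_of_dvd (X_dvd_onePlusXPow_sub_one p _) _)

/-- The ring of power series is complete for the `X`-adic topology. -/
theorem exists_powerSeries_of_compatible {A : Type*} [CommRing A]
    (d : ∀ k : ℕ, A⟦X⟧ ⧸ Ideal.span {(X : A⟦X⟧) ^ (k + 1)})
    (hd : ∀ (k l : ℕ) (h : Ideal.span {(X : A⟦X⟧) ^ (l + 1)} ≤ Ideal.span {(X : A⟦X⟧) ^ (k + 1)}),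
      k ≤ l → Ideal.Quotient.factor h (d l) = d k) :
    ∃ f : A⟦X⟧, ∀ k, Ideal.Quotient.mk _ f = d k := by
  choose e he using fun k => Ideal.Quotient.mk_surjective (d k)
  -- The `k`-th coefficient is determined modulo `X ^ (k + 1)`.
  refine ⟨PowerSeries.mk fun k => coeff k (e k), fun k => ?_⟩
  rw [← he k, Ideal.Quotient.eq, Ideal.mem_span_singleton, X_pow_dvd_iff]
  intro m hm
  have hle : Ideal.span {(X : A⟦X⟧) ^ (k + 1)} ≤ Ideal.span {(X : A⟦X⟧) ^ (m + 1)} :=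
    Ideal.span_singleton_le_span_singleton.2 (pow_dvd_pow X hm)
  have h := hd m k hle (Nat.lt_succ_iff.1 hm)
  rw [← he k, ← he m, Ideal.Quotient.factor_mk, Ideal.Quotient.eq, Ideal.mem_span_singleton,
    X_pow_dvd_iff] at h
  have h' := h m (Nat.lt_succ_self m)
  rw [map_sub, sub_eq_zero] at h' ⊢
  rw [coeff_mk, h']

variable {G : Type u} [Group G] [TopologicalSpace G]

/-- The canonical homomorphism from `G` to the multiplicative monoid of `Λ(G)`. -/
def lambdaOf : G →* Lambda p G where
  toFun g := ⟨fun U => MonoidAlgebra.single (QuotientGroup.mk g) 1, fun U V h => by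
    rw [transition, MonoidAlgebra.mapDomainRingHom_apply, MonoidAlgebra.mapDomain_single]
    rfl⟩
  map_one' := rfl
  map_mul' g h := lambda_ext fun U =>
    (congrArg (MonoidAlgebra.single (QuotientGroup.mk (g * h))) (mul_one 1).symm).trans
      (MonoidAlgebra.single_mul_single (QuotientGroup.mk g) (QuotientGroup.mk h) 1 1).symm

theorem lambdaProj_lambdaOf (U : OpenNormalSubgroup G) (g : G) :
    lambdaProj p U (lambdaOf p g) = MonoidAlgebra.single (QuotientGroup.mk g) 1 := rfl

/-- The structure homomorphism `ℤ_p → Λ(G)`. -/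
def lambdaScalar : ℤ_[p] →+* Lambda p G where
  toFun c := ⟨fun U => MonoidAlgebra.single 1 c, fun U V h => by
    rw [transition, MonoidAlgebra.mapDomainRingHom_apply, MonoidAlgebra.mapDomain_single, map_one]⟩
  map_one' := rfl
  map_mul' a b := lambda_ext fun U =>
    (congrArg (MonoidAlgebra.single · _) (mul_one 1).symm).trans
      (MonoidAlgebra.single_mul_single (1 : G ⧸ U.toSubgroup) 1 a b).symm
  map_zero' := lambda_ext fun U => MonoidAlgebra.single_zero _
  map_add' a b := lambda_ext fun U => MonoidAlgebra.single_add _ _ _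

theorem lambdaProj_lambdaScalar (U : OpenNormalSubgroup G) (c : ℤ_[p]) :
    lambdaProj p U (lambdaScalar p c) = MonoidAlgebra.single 1 c := rfl

variable {ι : Type*} [Fintype ι] [DecidableEq ι]

/-- A ring homomorphism from `ℤ_p` to a ring of matrices over `𝔽_p` is reduction modulo `p`. -/
theorem ringHom_padicInt_eq (f : ℤ_[p] →+* Matrix ι ι (ZMod p)) (c : ℤ_[p]) :
    f c = Matrix.scalar ι (PadicInt.toZMod c) := by
  have h := PadicInt.sub_zmodRepr_mem c
  rw [PadicInt.maximalIdeal_eq_span_p, Ideal.mem_span_singleton] at h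
  obtain ⟨d, hd⟩ := h
  have hp (M : Matrix ι ι (ZMod p)) : (p : Matrix ι ι (ZMod p)) * M = 0 := by
    rw [← map_natCast (Matrix.scalar ι), CharP.cast_eq_zero, map_zero, zero_mul]
  have hc := sub_eq_iff_eq_add.1 hd
  generalize c.zmodRepr = n at hc
  rw [hc, map_add, map_mul, map_natCast, map_natCast, hp, zero_add, map_add,
    map_mul, map_natCast, map_natCast, CharP.cast_eq_zero (ZMod p) p, zero_mul, zero_add,
    map_natCast]

/-- A representation of `Λ(G)` over `𝔽_p` that factors through `ℤ_p[G/U]` sends the elements of `U`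
to `1`. -/
theorem map_lambdaOf_eq_one {U : OpenNormalSubgroup G} {ρ : Lambda p G →+* Matrix ι ι (ZMod p)}
    (hρ : ∀ r, lambdaProj p U r = 0 → ρ r = 0) {g : G} (hg : g ∈ U) : ρ (lambdaOf p g) = 1 := by
  rw [← sub_eq_zero, ← map_one ρ, ← map_sub]
  refine hρ _ ?_
  rw [map_sub, map_one, lambdaProj_lambdaOf, (QuotientGroup.eq_one_iff g).2 hg, sub_eq_zero]
  rfl

theorem commute_scalar {A : Type*} [CommRing A] (a : A) (M : Matrix ι ι A) :
    Commute (Matrix.scalar ι a) M :=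
  Matrix.scalar_commute _ (fun _ => Commute.all _ _) M

/-- The representation of `ℤ_p[G/U]` through which `ρ` factors. -/
def levelRep {U : OpenNormalSubgroup G} (ρ : Lambda p G →+* Matrix ι ι (ZMod p))
    (hρ : ∀ r, lambdaProj p U r = 0 → ρ r = 0) :
    MonoidAlgebra ℤ_[p] (G ⧸ U.toSubgroup) →+* Matrix ι ι (ZMod p) :=
  MonoidAlgebra.liftNCRingHom ((Matrix.scalar ι).comp PadicInt.toZMod)
    (QuotientGroup.lift U.toSubgroup ((ρ : Lambda p G →* Matrix ι ι (ZMod p)).comp (lambdaOf p))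
      fun _ hg => map_lambdaOf_eq_one p hρ hg)
    fun _ _ => commute_scalar _ _

theorem levelRep_lambdaProj {U : OpenNormalSubgroup G} (ρ : Lambda p G →+* Matrix ι ι (ZMod p))
    (hρ : ∀ r, lambdaProj p U r = 0 → ρ r = 0) (r : Lambda p G) :
    levelRep p ρ hρ (lambdaProj p U r) = ρ r := by
  -- `Λ(G)` surjects onto `ℤ_p[G/U]`, and both maps agree on lifts of the generators.
  have key (a : MonoidAlgebra ℤ_[p] (G ⧸ U.toSubgroup)) :
      ∃ r, lambdaProj p U r = a ∧ ρ r = levelRep p ρ hρ a := by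
    induction a using MonoidAlgebra.induction_linear with
    | zero => exact ⟨0, map_zero _, by simp⟩
    | add x y hx hy =>
      obtain ⟨r, rfl, hr⟩ := hx
      obtain ⟨s, rfl, hs⟩ := hy
      exact ⟨r + s, map_add _ _ _, by rw [map_add, map_add, hr, hs]⟩
    | single q c =>
      obtain ⟨g, rfl⟩ := QuotientGroup.mk_surjective q
      refine ⟨lambdaScalar p c * lambdaOf p g, ?_, ?_⟩
      · rw [map_mul, lambdaProj_lambdaScalar, lambdaProj_lambdaOf,
          MonoidAlgebra.single_mul_single, one_mul, mul_one]
      · rw [map_mul, levelRep, MonoidAlgebra.liftNCRingHom_single]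
        congr 1
        exact ringHom_padicInt_eq p (ρ.comp (lambdaScalar p)) c
  obtain ⟨s, hs, hs'⟩ := key (lambdaProj p U r)
  rw [← hs', ← sub_eq_zero, ← map_sub]
  exact hρ _ (by rw [map_sub, hs, sub_self])

variable (χ : G →* Multiplicative ℤ_[p])

/-- The open normal subgroup `U ∩ χ⁻¹(pᵏ ℤ_p)`, on which the twist of a representation trivial on
`U` is trivial modulo `X ^ (k + 1)`. -/
def levelSubgroup (U : OpenNormalSubgroup G) (hχ : Continuous χ) (k : ℕ) : OpenNormalSubgroup G where
  toSubgroup := U.toSubgroup ⊓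
    ((PadicInt.toZModPow k).toAddMonoidHom.toMultiplicative.comp χ).ker
  isOpen' := by
    have : ((((PadicInt.toZModPow k).toAddMonoidHom.toMultiplicative.comp χ).ker : Subgroup G) :
        Set G) = (fun g => (χ g).toAdd) ⁻¹' Metric.closedBall 0 ((p : ℝ) ^ (-k : ℤ)) := by
      ext g
      rw [Set.mem_preimage, mem_closedBall_zero_iff, PadicInt.norm_le_pow_iff_mem_span_pow,
        ← PadicInt.ker_toZModPow]
      rfl
    refine U.isOpen.inter (this ▸ ?_)
    exact (IsUltrametricDist.isOpen_closedBall _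
      (zpow_pos (by exact_mod_cast (Fact.out : p.Prime).pos) _).ne').preimage
      (continuous_toAdd.comp hχ)

theorem levelSubgroup_le (U : OpenNormalSubgroup G) (hχ : Continuous χ) (k : ℕ) :
    levelSubgroup p χ U hχ k ≤ U := fun _ hx => hx.1

theorem levelSubgroup_anti (U : OpenNormalSubgroup G) (hχ : Continuous χ) {k l : ℕ} (h : k ≤ l) :
    levelSubgroup p χ U hχ l ≤ levelSubgroup p χ U hχ k := fun x hx => ⟨hx.1, by
  have h2 : PadicInt.toZModPow l (χ x).toAdd = 0 := hx.2
  change PadicInt.toZModPow k (χ x).toAdd = 0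
  rw [← PadicInt.cast_toZModPow k l h, h2, ZMod.cast_zero]⟩

/-- The twist `g ↦ (1 + X) ^ χ(g) ρ(g)` of the restriction of `ρ` to `G`. -/
def twist (ρ : Lambda p G →+* Matrix ι ι (ZMod p)) : G →* Matrix ι ι (ZMod p)⟦X⟧ where
  toFun g := Matrix.scalar ι (onePlusXPow p (χ g)) *
    (C (R := ZMod p)).mapMatrix (ρ (lambdaOf p g))
  map_one' := by simp
  map_mul' g h := by
    rw [map_mul, map_mul, map_mul, map_mul, map_mul, map_mul, mul_assoc, mul_assoc,
      ← mul_assoc (Matrix.scalar ι (onePlusXPow p (χ h))),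
      (commute_scalar (onePlusXPow p (χ h)) _).eq]
    simp only [mul_assoc]

/-- The ideal `(X ^ (k + 1))` of `𝔽_p⟦X⟧`. -/
abbrev truncIdeal (k : ℕ) : Ideal (ZMod p)⟦X⟧ := Ideal.span {X ^ (k + 1)}

/-- The reduction of the twist of `ρ` modulo `X ^ (k + 1)`, extended to the group ring of
the quotient of `G` by `levelSubgroup`. -/
def levelTwist {U : OpenNormalSubgroup G} (hχ : Continuous χ)
    (ρ : Lambda p G →+* Matrix ι ι (ZMod p))
    (hρ : ∀ r, lambdaProj p U r = 0 → ρ r = 0) (k : ℕ) :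
    MonoidAlgebra ℤ_[p] (G ⧸ (levelSubgroup p χ U hχ k).toSubgroup) →+*
      Matrix ι ι ((ZMod p)⟦X⟧ ⧸ truncIdeal p k) :=
  MonoidAlgebra.liftNCRingHom
    ((Matrix.scalar ι).comp (((Ideal.Quotient.mk (truncIdeal p k)).comp C).comp PadicInt.toZMod))
    (QuotientGroup.lift (levelSubgroup p χ U hχ k).toSubgroup
      (((Ideal.Quotient.mk (truncIdeal p k)).mapMatrix (m := ι)).toMonoidHom.comp (twist p χ ρ))
      fun g hg => by
        have h1 : Ideal.Quotient.mk (truncIdeal p k) (onePlusXPow p (χ g)) = 1 := by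
          rw [← sub_eq_zero, ← map_one (Ideal.Quotient.mk (truncIdeal p k)), ← map_sub,
            Ideal.Quotient.eq_zero_iff_mem, Ideal.mem_span_singleton]
          exact X_pow_dvd_onePlusXPow_sub_one p k _ hg.2
        have h2 : twist p χ ρ g = Matrix.scalar ι (onePlusXPow p (χ g)) := by
          change Matrix.scalar ι (onePlusXPow p (χ g)) *
            (C (R := ZMod p)).mapMatrix (ρ (lambdaOf p g)) = _
          rw [map_lambdaOf_eq_one p hρ hg.1, map_one, mul_one]
        change (Ideal.Quotient.mk (truncIdeal p k)).mapMatrix (twist p χ ρ g) = 1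
        rw [h2, RingHom.mapMatrix_apply, Matrix.scalar_apply,
          Matrix.diagonal_map (map_zero _)]
        simp only [h1]
        exact Matrix.diagonal_one)
    fun _ _ => commute_scalar _ _

theorem levelTwist_single_one {U : OpenNormalSubgroup G} (hχ : Continuous χ)
    (ρ : Lambda p G →+* Matrix ι ι (ZMod p)) (hρ : ∀ r, lambdaProj p U r = 0 → ρ r = 0) (k : ℕ)
    (g : G) :
    levelTwist p χ hχ ρ hρ k (MonoidAlgebra.single (QuotientGroup.mk g) 1) =
      (Ideal.Quotient.mk (truncIdeal p k)).mapMatrix (twist p χ ρ g) := by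
  rw [levelTwist, MonoidAlgebra.liftNCRingHom_single, map_one, one_mul]
  rfl

theorem levelTwist_single_scalar {U : OpenNormalSubgroup G} (hχ : Continuous χ)
    (ρ : Lambda p G →+* Matrix ι ι (ZMod p)) (hρ : ∀ r, lambdaProj p U r = 0 → ρ r = 0) (k : ℕ)
    (c : ℤ_[p]) :
    levelTwist p χ hχ ρ hρ k (MonoidAlgebra.single 1 c) =
      Matrix.scalar ι (Ideal.Quotient.mk (truncIdeal p k) (C (PadicInt.toZMod c))) := by
  rw [levelTwist, MonoidAlgebra.liftNCRingHom_single, map_one, mul_one]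
  rfl

theorem mapMatrix_scalar {A B : Type*} [CommRing A] [CommRing B] (f : A →+* B) (a : A) :
    f.mapMatrix (Matrix.scalar ι a) = Matrix.scalar ι (f a) := by
  rw [RingHom.mapMatrix_apply, Matrix.scalar_apply, Matrix.diagonal_map (map_zero _),
    Matrix.scalar_apply]

theorem factor_levelTwist {U : OpenNormalSubgroup G} (hχ : Continuous χ)
    (ρ : Lambda p G →+* Matrix ι ι (ZMod p)) (hρ : ∀ r, lambdaProj p U r = 0 → ρ r = 0) {k l : ℕ}
    (hkl : k ≤ l) (h : truncIdeal p l ≤ truncIdeal p k) (r : Lambda p G) :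
    (Ideal.Quotient.factor h).mapMatrix (levelTwist p χ hχ ρ hρ l (lambdaProj p _ r)) =
      levelTwist p χ hχ ρ hρ k (lambdaProj p _ r) := by
  have hle := levelSubgroup_anti p χ U hχ hkl
  have key : (Ideal.Quotient.factor h).mapMatrix.comp (levelTwist p χ hχ ρ hρ l) =
      (levelTwist p χ hχ ρ hρ k).comp (transition p _ _ hle) := by
    refine MonoidAlgebra.ringHom_ext (fun c => ?_) fun q => ?_
    · rw [RingHom.comp_apply, RingHom.comp_apply, transition, MonoidAlgebra.mapDomainRingHom_apply,
        MonoidAlgebra.mapDomain_single, map_one, levelTwist_single_scalar,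
        levelTwist_single_scalar, mapMatrix_scalar, Ideal.Quotient.factor_mk]
    · obtain ⟨g, rfl⟩ := QuotientGroup.mk_surjective q
      rw [RingHom.comp_apply, RingHom.comp_apply, transition, MonoidAlgebra.mapDomainRingHom_apply,
        MonoidAlgebra.mapDomain_single, levelTwist_single_one]
      exact (levelTwist_single_one p χ hχ ρ hρ k g).symm
  rw [← transition_lambdaProj p hle]
  exact RingHom.congr_fun key _

theorem matrix_powerSeries_ext {A : Type*} [CommRing A] {M N : Matrix ι ι A⟦X⟧}
    (h : ∀ k : ℕ, (Ideal.Quotient.mk (Ideal.span {(X : A⟦X⟧) ^ (k + 1)})).mapMatrix M =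
      (Ideal.Quotient.mk (Ideal.span {(X : A⟦X⟧) ^ (k + 1)})).mapMatrix N) : M = N := by
  ext i j k
  have := congrFun (congrFun (h k) i) j
  rw [RingHom.mapMatrix_apply, RingHom.mapMatrix_apply, Matrix.map_apply, Matrix.map_apply,
    Ideal.Quotient.eq, Ideal.mem_span_singleton, X_pow_dvd_iff] at this
  have := this k (Nat.lt_succ_self k)
  rwa [map_sub, sub_eq_zero] at this

/-- The reductions of the twist are compatible and define a representation of `Λ(G)` over the
complete ring `𝔽_p⟦X⟧`. -/
theorem exists_twist_extension {U : OpenNormalSubgroup G} (hχ : Continuous χ)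
    (ρ : Lambda p G →+* Matrix ι ι (ZMod p)) (hρ : ∀ r, lambdaProj p U r = 0 → ρ r = 0) :
    ∃ Θ : Lambda p G →+* Matrix ι ι (ZMod p)⟦X⟧, ∀ k r,
      (Ideal.Quotient.mk (truncIdeal p k)).mapMatrix (Θ r) =
        levelTwist p χ hχ ρ hρ k (lambdaProj p _ r) := by
  have key (r : Lambda p G) : ∃ M : Matrix ι ι (ZMod p)⟦X⟧, ∀ k,
      (Ideal.Quotient.mk (truncIdeal p k)).mapMatrix M =
        levelTwist p χ hχ ρ hρ k (lambdaProj p _ r) := by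
    have (i j : ι) := exists_powerSeries_of_compatible
      (fun k => levelTwist p χ hχ ρ hρ k (lambdaProj p _ r) i j) fun k l h hkl =>
        congrFun (congrFun (factor_levelTwist p χ hχ ρ hρ hkl h r) i) j
    choose M hM using this
    exact ⟨Matrix.of M, fun k => Matrix.ext fun i j => hM i j k⟩
  choose Θ hΘ using key
  exact ⟨
    { toFun := Θ
      map_one' := matrix_powerSeries_ext fun k => (hΘ _ k).trans (by simp only [map_one])
      map_mul' := fun r s => matrix_powerSeries_ext fun k => (hΘ _ k).trans (by
        rw [map_mul, map_mul, map_mul, hΘ, hΘ])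
      map_zero' := matrix_powerSeries_ext fun k => (hΘ _ k).trans (by simp only [map_zero])
      map_add' := fun r s => matrix_powerSeries_ext fun k => (hΘ _ k).trans (by
        rw [map_add, map_add, map_add, hΘ, hΘ]) }, fun k r => hΘ r k⟩

/-- A representation `ρ` of `Λ(G)` over `𝔽_p` that factors through a finite quotient of `G` is the
special fibre of a representation over `𝔽_p⟦X⟧` on which `g ∈ G` acts by `(1 + X) ^ χ(g) ρ(g)`.
It is constant on the Iwasawa algebra of a subgroup of the kernel of `χ`. -/
theorem exists_deformation {U : OpenNormalSubgroup G} (hχ : Continuous χ)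
    (ρ : Lambda p G →+* Matrix ι ι (ZMod p)) (hρ : ∀ r, lambdaProj p U r = 0 → ρ r = 0) :
    ∃ Θ : Lambda p G →+* Matrix ι ι (ZMod p)⟦X⟧,
      (∀ r, (constantCoeff (R := ZMod p)).mapMatrix (Θ r) = ρ r) ∧
      (∀ g, Θ (lambdaOf p g) = Matrix.scalar ι (onePlusXPow p (χ g)) *
        (C (R := ZMod p)).mapMatrix (ρ (lambdaOf p g))) ∧
      ∀ H : Subgroup G, H ≤ χ.ker → ∀ h : Lambda p H,
        Θ (lambdaIncl p H h) = (C (R := ZMod p)).mapMatrix (ρ (lambdaIncl p H h)) := by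
  obtain ⟨Θ, hΘ⟩ := exists_twist_extension p χ hχ ρ hρ
  refine ⟨Θ, fun r => ?_, fun g => matrix_powerSeries_ext fun k => ?_,
    fun H hH h => matrix_powerSeries_ext fun k => ?_⟩
  · let cc : (ZMod p)⟦X⟧ ⧸ truncIdeal p 0 →+* ZMod p :=
      Ideal.Quotient.lift _ constantCoeff fun a ha => by
        rwa [Ideal.mem_span_singleton, zero_add, pow_one, X_dvd_iff] at ha
    have hle := levelSubgroup_le p χ U hχ 0
    have key : cc.mapMatrix.comp (levelTwist p χ hχ ρ hρ 0) =
        (levelRep p ρ hρ).comp (transition p _ _ hle) := by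
      refine MonoidAlgebra.ringHom_ext (fun c => ?_) fun q => ?_
      · rw [RingHom.comp_apply, RingHom.comp_apply, transition,
          MonoidAlgebra.mapDomainRingHom_apply, MonoidAlgebra.mapDomain_single, map_one,
          levelTwist_single_scalar, mapMatrix_scalar, levelRep,
          MonoidAlgebra.liftNCRingHom_single, map_one, mul_one]
        simp [cc]
      · obtain ⟨g, rfl⟩ := QuotientGroup.mk_surjective q
        rw [RingHom.comp_apply, levelTwist_single_one, RingHom.comp_apply, transition,
          MonoidAlgebra.mapDomainRingHom_apply, MonoidAlgebra.mapDomain_single, levelRep,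
          MonoidAlgebra.liftNCRingHom_single, map_one, one_mul]
        have h1 : cc.mapMatrix ((Ideal.Quotient.mk (truncIdeal p 0)).mapMatrix (twist p χ ρ g)) =
            (constantCoeff (R := ZMod p)).mapMatrix (twist p χ ρ g) := rfl
        have h2 : (constantCoeff (R := ZMod p)).mapMatrix
            ((C (R := ZMod p)).mapMatrix (ρ (lambdaOf p g))) = ρ (lambdaOf p g) := by
          ext i j
          simp
        have h3 := X_dvd_onePlusXPow_sub_one p (χ g)
        rw [X_dvd_iff, map_sub, map_one, sub_eq_zero] at h3
        rw [h1, twist, MonoidHom.coe_mk, OneHom.coe_mk, map_mul, mapMatrix_scalar, h3, h2, map_one,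
          one_mul]
        rfl
    have h := RingHom.congr_fun key (lambdaProj p _ r)
    rw [RingHom.comp_apply, RingHom.comp_apply, transition_lambdaProj, levelRep_lambdaProj,
      ← hΘ 0] at h
    rw [← h]
    ext i j
    simp [cc]
  · rw [hΘ]
    exact levelTwist_single_one p χ hχ ρ hρ k g
  · have hle := levelSubgroup_le p χ U hχ k
    have key : (levelTwist p χ hχ ρ hρ k).comp (inclLevel p H _) =
        ((Ideal.Quotient.mk (truncIdeal p k)).mapMatrix.comp ((C (R := ZMod p)).mapMatrix.comp
          ((levelRep p ρ hρ).comp (transition p _ _ hle)))).comp (inclLevel p H _) := by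
      refine MonoidAlgebra.ringHom_ext (fun c => ?_) fun q => ?_
      · have h1 : inclLevel p H (levelSubgroup p χ U hχ k) (MonoidAlgebra.single 1 c) =
            MonoidAlgebra.single 1 c := by
          rw [inclLevel, MonoidAlgebra.mapDomainRingHom_apply, MonoidAlgebra.mapDomain_single,
            map_one]
        simp only [RingHom.comp_apply]
        rw [h1, levelTwist_single_scalar, transition, MonoidAlgebra.mapDomainRingHom_apply,
          MonoidAlgebra.mapDomain_single, map_one, levelRep, MonoidAlgebra.liftNCRingHom_single,
          map_one, mul_one, RingHom.comp_apply, mapMatrix_scalar, mapMatrix_scalar]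
      · obtain ⟨g, rfl⟩ := QuotientGroup.mk_surjective q
        have h1 : inclLevel p H (levelSubgroup p χ U hχ k)
            (MonoidAlgebra.single (QuotientGroup.mk g) 1) =
              MonoidAlgebra.single (QuotientGroup.mk (g : G)) 1 := by
          rw [inclLevel, MonoidAlgebra.mapDomainRingHom_apply, MonoidAlgebra.mapDomain_single]
          rfl
        have h2 : twist p χ ρ g = (C (R := ZMod p)).mapMatrix (ρ (lambdaOf p (g : G))) := by
          have h3 : χ g = 1 := hH g.2
          rw [twist, MonoidHom.coe_mk, OneHom.coe_mk, h3, map_one, map_one, one_mul]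
        simp only [RingHom.comp_apply]
        rw [h1, levelTwist_single_one, h2, transition, MonoidAlgebra.mapDomainRingHom_apply,
          MonoidAlgebra.mapDomain_single, levelRep, MonoidAlgebra.liftNCRingHom_single, map_one,
          one_mul]
        rfl
    rw [hΘ, ← levelRep_lambdaProj p ρ hρ, ← transition_lambdaProj p hle]
    exact RingHom.congr_fun key (lambdaProj p _ h)

end Deformation

/-! ### Homomorphisms into matrix representations -/

section MatrixModule

variable {R : Type u} [Ring R] {A₀ A B : Type} [CommRing A₀] [CommRing A] [CommRing B]
  [Algebra A₀ A] {ι : Type u} [Fintype ι] [DecidableEq ι]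

/-- The module `A^ι` on which `R` acts through the matrix representation `Θ`. -/
def MatrixModule (_ : R →+* Matrix ι ι A) : Type u := ι → A

namespace MatrixModule

instance (Θ : R →+* Matrix ι ι A) : AddCommGroup (MatrixModule Θ) :=
  inferInstanceAs (AddCommGroup (ι → A))

instance instModuleScalar (Θ : R →+* Matrix ι ι A) : Module A₀ (MatrixModule Θ) :=
  inferInstanceAs (Module A₀ (ι → A))

instance instModuleRing (Θ : R →+* Matrix ι ι A) : Module R (MatrixModule Θ) :=
  Module.compHom (ι → A) ((Matrix.toLinAlgEquiv' (R := A) (n := ι)).toRingEquiv.toRingHom.comp Θ)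

instance (Θ : R →+* Matrix ι ι A) : SMulCommClass R A₀ (MatrixModule Θ) :=
  ⟨fun r a w => Matrix.mulVec_smul (Θ r) a (w : ι → A)⟩

instance (Θ : R →+* Matrix ι ι A) : IsScalarTower A₀ A (MatrixModule Θ) :=
  inferInstanceAs (IsScalarTower A₀ A (ι → A))

/-- Extension of scalars along `f : A → B`. -/
def map (f : A →+* B) (Θ : R →+* Matrix ι ι A) :
    MatrixModule Θ →ₗ[R] MatrixModule (f.mapMatrix.comp Θ) where
  toFun w := fun i => f (w i)
  map_add' _ _ := funext fun _ => map_add f _ _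
  map_smul' r w := funext fun i => RingHom.map_mulVec f (Θ r) w i

theorem map_smul_coe (f : A →+* B) (Θ : R →+* Matrix ι ι A) (a : A) (w : MatrixModule Θ) :
    map f Θ (a • w) = f a • map f Θ w := funext fun i => map_mul f a (w i)

variable (P : Type*) [AddCommGroup P] [Module R P]

instance isTorsionFree_hom [IsDomain A] (Θ : R →+* Matrix ι ι A) :
    Module.IsTorsionFree A (P →ₗ[R] MatrixModule Θ) where
  isSMulRegular _ ha _ _ h := LinearMap.ext fun x => funext fun i =>
    mul_left_cancel₀ ha.ne_zero (congrFun (LinearMap.congr_fun h x) i)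

/-- For finitely generated projective `P`, the module `Hom(P, A^ι)` is finitely generated. -/
instance finite_hom [Module.Finite R P] [Module.Projective R P]
    (Θ : R →+* Matrix ι ι A) : Module.Finite A (P →ₗ[R] MatrixModule Θ) := by
  obtain ⟨n, r, hr⟩ := Module.Finite.exists_fin' R P
  obtain ⟨i, hi⟩ := Module.projective_lifting_property r LinearMap.id hr
  have : Module.Finite A (MatrixModule Θ) := inferInstanceAs (Module.Finite A (ι → A))
  let φ : (Fin n → MatrixModule Θ) →ₗ[A] (P →ₗ[R] MatrixModule Θ) :=
    { toFun := fun w =>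
        { toFun := fun x => ∑ k, i x k • w k
          map_add' := fun x y => by simp [add_smul, Finset.sum_add_distrib]
          map_smul' := fun s x => by simp [mul_smul, Finset.smul_sum] }
      map_add' := fun w w' => by ext x; simp [Finset.sum_add_distrib]
      map_smul' := fun a w => by ext x; simp [Finset.smul_sum, smul_comm _ a] }
  refine Module.Finite.of_surjective φ fun f => ⟨fun k => f (r (Pi.single k 1)), ?_⟩
  have hf : Fintype.linearCombination R (fun k => f (r (Pi.single k 1))) = f ∘ₗ r :=
    (Pi.basisFun R (Fin n)).ext fun k => by simp
  ext x
  change Fintype.linearCombination R (fun k => f (r (Pi.single k 1))) (i x) = f x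
  rw [hf]
  exact congrArg f (LinearMap.congr_fun hi x)

/-- Extension of scalars on homomorphisms, `Hom(P, A₀^ι) → Hom(P, A^ι)`. -/
def homMap (A : Type) [CommRing A] [Algebra A₀ A] (Θ : R →+* Matrix ι ι A₀) :
    (P →ₗ[R] MatrixModule Θ) →ₗ[A₀]
      (P →ₗ[R] MatrixModule ((algebraMap A₀ A).mapMatrix.comp Θ)) where
  toFun f := map (algebraMap A₀ A) Θ ∘ₗ f
  map_add' f g := by ext; simp
  map_smul' a f := LinearMap.ext fun x => funext fun i =>
    (map_mul (algebraMap A₀ A) a (f x i)).trans (Algebra.smul_def _ _).symm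

/-- `Hom(P, K^ι)` is the localisation of `Hom(P, D^ι)` for a domain `D` with fraction
field `K`: the values of a homomorphism on finitely many generators have a common denominator. -/
theorem isLocalizedModule_homMap [Module.Finite R P] {D : Type} (K : Type) [CommRing D] [IsDomain D]
    [Field K] [Algebra D K] [IsFractionRing D K] (Θ : R →+* Matrix ι ι D) :
    IsLocalizedModule (nonZeroDivisors D) (homMap P K Θ) := by
  have hinj : Function.Injective (map (algebraMap D K) Θ) := fun v w h =>
    funext fun i => IsFractionRing.injective D K (congrFun h i)
  constructor
  · intro d
    have hd : algebraMap D K d ≠ 0 := by simp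
    rw [Module.End.isUnit_iff]
    have (f : P →ₗ[R] MatrixModule ((algebraMap D K).mapMatrix.comp Θ)) :
        algebraMap D (Module.End D _) d f = algebraMap D K d • f := by
      rw [Module.algebraMap_end_apply, algebraMap_smul]
    constructor
    · intro f g h
      rw [this, this] at h
      exact smul_right_injective _ hd h
    · intro f
      exact ⟨(algebraMap D K d)⁻¹ • f, by rw [this, smul_inv_smul₀ hd]⟩
  · intro y
    obtain ⟨n, r, hr⟩ := Module.Finite.exists_fin' R P
    obtain ⟨d, hd⟩ := IsLocalization.exist_integer_multiples_of_finite (nonZeroDivisors D)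
      (fun k : Fin n × ι => y (r (Pi.single k.1 1)) k.2)
    have hrange (x : P) : (d • y) x ∈ LinearMap.range (map (algebraMap D K) Θ) := by
      obtain ⟨c, rfl⟩ := hr x
      have : (d • y) ∘ₗ r = Fintype.linearCombination R fun k => (d • y) (r (Pi.single k 1)) :=
        (Pi.basisFun R (Fin n)).ext fun k => by simp
      rw [← LinearMap.comp_apply, this, Fintype.linearCombination_apply]
      refine Submodule.sum_mem _ fun k _ => Submodule.smul_mem _ _ ?_
      choose w hw using fun i => hd (k, i)
      exact ⟨w, funext hw⟩
    let e := LinearEquiv.ofInjective (map (algebraMap D K) Θ) hinj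
    refine ⟨(e.symm.toLinearMap ∘ₗ (d • y).codRestrict _ hrange, d), ?_⟩
    ext x
    exact (congrArg Subtype.val (e.apply_symm_apply ⟨(d • y) x, hrange x⟩)).symm
  · intro f g h
    refine ⟨1, ?_⟩
    rw [show f = g from LinearMap.ext fun x => hinj (LinearMap.congr_fun h x)]

open PowerSeries in
/-- The rank of `Hom(P, k⟦X⟧^ι)` is the dimension of `Hom(P, k^ι)`, because `Hom(P, -)` is exact. -/
theorem card_hom_constantCoeff {k : Type} [Field k] [Finite k] [Module.Finite R P]
    [Module.Projective R P] (Θ : R →+* Matrix ι ι k⟦X⟧) :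
    Nat.card (P →ₗ[R] MatrixModule ((constantCoeff (R := k)).mapMatrix.comp Θ)) =
      Nat.card k ^ Module.finrank k⟦X⟧ (P →ₗ[R] MatrixModule Θ) := by
  have hfree : Module.Free k⟦X⟧ (P →ₗ[R] MatrixModule Θ) := inferInstance
  let b := Module.finBasis k⟦X⟧ (P →ₗ[R] MatrixModule Θ)
  let m := map (constantCoeff (R := k)) Θ
  have hm : Function.Surjective m := fun w => ⟨fun i => C (w i), funext fun i =>
    constantCoeff_C (w i)⟩
  have hmX (w : MatrixModule Θ) (hw : m w = 0) : ∃ v : MatrixModule Θ, w = (X : k⟦X⟧) • v := by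
    have (i : ι) : (X : k⟦X⟧) ∣ w i := X_dvd_iff.2 (congrFun hw i)
    choose v hv using this
    exact ⟨v, funext hv⟩
  have hX (f : P →ₗ[R] MatrixModule Θ) (hf : m ∘ₗ f = 0) :
      ∃ g : P →ₗ[R] MatrixModule Θ, f = (X : k⟦X⟧) • g := by
    let L : MatrixModule Θ →ₗ[R] MatrixModule Θ := (X : k⟦X⟧) • LinearMap.id
    have hL : Function.Injective L := fun v w h => funext fun i =>
      mul_left_cancel₀ X_ne_zero (congrFun h i)
    have hrange (x : P) : f x ∈ LinearMap.range L := by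
      obtain ⟨v, hv⟩ := hmX (f x) (LinearMap.congr_fun hf x)
      exact ⟨v, hv.symm⟩
    let e := LinearEquiv.ofInjective L hL
    refine ⟨e.symm.toLinearMap ∘ₗ f.codRestrict _ hrange, ?_⟩
    ext x
    exact (congrArg Subtype.val (e.apply_symm_apply ⟨f x, hrange x⟩)).symm
  -- The constant combinations of a basis of `Hom(P, k⟦X⟧^ι)` represent each class modulo `X` once.
  let ψ (c : Fin (Module.finrank k⟦X⟧ (P →ₗ[R] MatrixModule Θ)) → k) :
      P →ₗ[R] MatrixModule ((constantCoeff (R := k)).mapMatrix.comp Θ) :=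
    m ∘ₗ ∑ j, C (c j) • b j
  have hψ : Function.Bijective ψ := by
    constructor
    · intro c c' h
      have h0 : m ∘ₗ (∑ j, C (c j) • b j - ∑ j, C (c' j) • b j) = 0 := by
        rw [LinearMap.comp_sub, sub_eq_zero]
        exact h
      obtain ⟨g, hg⟩ := hX _ h0
      funext j
      have hj := congrArg (fun f => constantCoeff (b.repr f j)) hg
      simpa [Finsupp.single_apply, sub_eq_zero] using hj
    · intro f
      obtain ⟨g, rfl⟩ := Module.projective_lifting_property m f hm
      have hdvd (j) : (X : k⟦X⟧) ∣ b.repr g j - C (constantCoeff (b.repr g j)) :=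
        X_dvd_iff.2 (by simp)
      choose d hd using hdvd
      refine ⟨fun j => constantCoeff (b.repr g j), ?_⟩
      have hg : g = ∑ j, C (constantCoeff (b.repr g j)) • b j + (X : k⟦X⟧) • ∑ j, d j • b j := by
        rw [Finset.smul_sum, ← Finset.sum_add_distrib]
        conv_lhs => rw [← b.sum_repr g]
        refine Finset.sum_congr rfl fun j _ => ?_
        rw [smul_smul, ← add_smul, ← hd]
        congr 1
        abel
      ext x
      conv_rhs => rw [hg]
      simp only [ψ, LinearMap.comp_apply, LinearMap.add_apply, LinearMap.smul_apply, map_add]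
      rw [map_smul_coe, constantCoeff_X, zero_smul, add_zero]
  rw [← Nat.card_congr (Equiv.ofBijective ψ hψ), Nat.card_fun, Nat.card_fin]

end MatrixModule
end MatrixModule

/-! ### Invertibility of the canonical Ore set on deformations -/

section Localisation

namespace MatrixModule

variable {R R' : Type u} [Ring R] [Ring R'] {A₀ A : Type} [CommRing A₀] [CommRing A]
  [Algebra A₀ A] {ι : Type u} [Fintype ι] [DecidableEq ι]

/-- The universal property of `R' ⊗_R P`, for homomorphisms to a matrix representation of `R'`. -/
def homBaseChangeEquiv (A₀ : Type) [CommRing A₀] [Algebra A₀ A] (f : R →+* R')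
    (Θ : R' →+* Matrix ι ι A) (P : Type u) [AddCommGroup P] [Module R P] :
    (BaseChange f P →ₗ[R'] MatrixModule Θ) ≃ₗ[A₀] (P →ₗ[R] MatrixModule (Θ.comp f)) where
  toFun g :=
    { toFun := fun x => g (BaseChange.of f P x)
      map_add' := fun x y => (congrArg g (map_add _ x y)).trans (map_add g _ _)
      map_smul' := fun r x => (congrArg g (LinearMap.map_smulₛₗ _ r x)).trans (map_smul g _ _) }
  invFun g := BaseChange.lift f (M := MatrixModule Θ)
    { toFun := fun x => g x
      map_add' := fun x y => map_add g x y
      map_smul' := fun r x => map_smul g r x }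
  left_inv _ := BaseChange.hom_ext fun x => BaseChange.lift_of f _ x
  right_inv g := LinearMap.ext fun x => BaseChange.lift_of f (M := MatrixModule Θ)
    { toFun := fun x => g x
      map_add' := fun x y => map_add g x y
      map_smul' := fun r x => map_smul g r x } x
  map_add' _ _ := rfl
  map_smul' _ _ := rfl

/-- For modules that become isomorphic over `R'`, the spaces of homomorphisms to a representation
of `R'` have the same dimension. -/
theorem finrank_hom_comp_eq (A₀ : Type) [CommRing A₀] [Algebra A₀ A] (f : R →+* R')
    (Θ : R' →+* Matrix ι ι A) (P Q : Type u)
    [AddCommGroup P] [Module R P] [AddCommGroup Q] [Module R Q]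
    (α : BaseChange f P ≃ₗ[R'] BaseChange f Q) :
    Module.finrank A₀ (P →ₗ[R] MatrixModule (Θ.comp f)) =
      Module.finrank A₀ (Q →ₗ[R] MatrixModule (Θ.comp f)) := by
  let e : (BaseChange f P →ₗ[R'] MatrixModule Θ) ≃ₗ[A₀]
      (BaseChange f Q →ₗ[R'] MatrixModule Θ) :=
    { toFun := fun g => g ∘ₗ α.symm.toLinearMap
      invFun := fun g => g ∘ₗ α.toLinearMap
      left_inv := fun g => by ext x; simp
      right_inv := fun g => by ext x; simp
      map_add' := fun g h => rfl
      map_smul' := fun a g => rfl }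
  exact ((homBaseChangeEquiv A₀ f Θ P).symm.trans
    (e.trans (homBaseChangeEquiv A₀ f Θ Q))).finrank_eq

end MatrixModule

/-- The finiteness condition on `R/Rs`, in terms of elements of `R`. -/
theorem exists_generators_of_mem_finiteQuotientSet {A R : Type u} [Ring A] [Ring R] (f : A →+* R)
    {s : R} (hs : s ∈ finiteQuotientSet f) : ∃ (n : ℕ) (y : Fin n → R), ∀ x, ∃ (c : Fin n → A)
      (a : R), x = ∑ i, f (c i) * y i + a * s := by
  let _ : Module A (R ⧸ Submodule.span R {s}) := Module.compHom (R ⧸ Submodule.span R {s}) f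
  have : Module.Finite A (R ⧸ Submodule.span R {s}) := hs
  obtain ⟨n, z, hz⟩ := Module.Finite.exists_fin (R := A) (M := R ⧸ Submodule.span R {s})
  choose y hy using fun i => Submodule.mkQ_surjective _ (z i)
  refine ⟨n, y, fun x => ?_⟩
  have hx : (Submodule.span R {s}).mkQ x ∈ Submodule.span A (Set.range z) := hz ▸ trivial
  obtain ⟨c, hc⟩ := (Submodule.mem_span_range_iff_exists_fun A).1 hx
  have h : x - ∑ i, f (c i) * y i ∈ Submodule.span R {s} := by
    rw [← Submodule.Quotient.mk_eq_zero, ← Submodule.mkQ_apply, map_sub, ← hc, map_sum, sub_eq_zero]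
    refine Finset.sum_congr rfl fun i _ => ?_
    rw [← smul_eq_mul, map_smul, hy]
    rfl
  obtain ⟨a, ha⟩ := Submodule.mem_span_singleton.1 h
  exact ⟨c, a, by rw [← smul_eq_mul a s, ha]; abel⟩

open PowerSeries

theorem one_add_X_pow_injective (A : Type*) [CommRing A] [Nontrivial A] :
    Function.Injective fun n : ℕ => (1 + X : A⟦X⟧) ^ n := by
  intro a b h
  have hc (n : ℕ) : (((Polynomial.X + Polynomial.C 1 : Polynomial A) ^ n : Polynomial A) : A⟦X⟧) =
      (1 + X) ^ n := by
    simp [add_comm]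
  dsimp only at h
  rw [← hc, ← hc, Polynomial.coe_inj] at h
  have := congrArg Polynomial.natDegree h
  rwa [Polynomial.natDegree_pow_X_add_C, Polynomial.natDegree_pow_X_add_C] at this

variable (p : ℕ) [Fact p.Prime] {G : Type u} [Group G] [TopologicalSpace G]

/-- The elements of the canonical Ore set act invertibly on the generic fibre of a deformation along
`χ`. If `s w = 0`, then `Λ(G) w` is a quotient of `Λ(G)/Λ(G)s`, hence finite because `Λ(H)` acts
through a finite ring; but powers of an element `γ` with `χ(γ) = 1` move `w` to infinitely many
vectors unless `w = 0`. -/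
theorem isUnit_deformation {ι : Type u} [Fintype ι] [DecidableEq ι] (H : Subgroup G)
    (χ : G →* Multiplicative ℤ_[p]) (hχ : Function.Surjective χ)
    (ρ : Lambda p G →+* Matrix ι ι (ZMod p)) (Θ : Lambda p G →+* Matrix ι ι (ZMod p)⟦X⟧)
    (hΘ : ∀ g, Θ (lambdaOf p g) = Matrix.scalar ι (onePlusXPow p (χ g)) *
        (C (R := ZMod p)).mapMatrix (ρ (lambdaOf p g)))
    (hΘH : ∀ h : Lambda p H,
        Θ (lambdaIncl p H h) = (C (R := ZMod p)).mapMatrix (ρ (lambdaIncl p H h)))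
    (K : Type) [Field K] [Algebra (ZMod p)⟦X⟧ K] [IsFractionRing (ZMod p)⟦X⟧ K]
    {s : Lambda p G} (hs : s ∈ canonicalOreSet p H) :
    IsUnit ((algebraMap (ZMod p)⟦X⟧ K).mapMatrix.comp Θ s) := by
  set ΘK : Lambda p G →+* Matrix ι ι K := (algebraMap (ZMod p)⟦X⟧ K).mapMatrix.comp Θ with hΘK
  rw [← Matrix.mulVec_injective_iff_isUnit]
  suffices h : ∀ w, (ΘK s).mulVec w = 0 → w = 0 by
    intro v w hvw
    rw [← sub_eq_zero]
    exact h _ (by rw [Matrix.mulVec_sub, sub_eq_zero]; exact hvw)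
  intro w hw
  obtain ⟨n, y, hy⟩ := exists_generators_of_mem_finiteQuotientSet _ hs
  -- `Λ(H)` acts through the constant matrices over `𝔽_p`, so `Λ(G) w` lies in the range of a map
  -- with finite domain.
  let T (N : Fin n → Matrix ι ι (ZMod p)) : ι → K :=
    ∑ i, ((algebraMap (ZMod p)⟦X⟧ K).mapMatrix ((C (R := ZMod p)).mapMatrix (N i))).mulVec
      ((ΘK (y i)).mulVec w)
  have hT (x : Lambda p G) : (ΘK x).mulVec w ∈ Set.range T := by
    obtain ⟨c, a, hx⟩ := hy x
    refine ⟨fun i => ρ (lambdaIncl p H (c i)), ?_⟩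
    rw [hx, map_add, map_sum, Matrix.add_mulVec, map_mul ΘK a s, ← Matrix.mulVec_mulVec w, hw,
      Matrix.mulVec_zero, add_zero, Matrix.sum_mulVec]
    refine Finset.sum_congr rfl fun i _ => ?_
    rw [map_mul, ← Matrix.mulVec_mulVec, hΘK, RingHom.comp_apply _ _ (lambdaIncl p H (c i)), hΘH]
  obtain ⟨γ, hγ⟩ := hχ (Multiplicative.ofAdd 1)
  obtain ⟨m, hm, hγm⟩ : ∃ m, 0 < m ∧ ρ (lambdaOf p γ) ^ m = 1 := by
    obtain ⟨m, hm, h⟩ := isOfFinOrder_iff_pow_eq_one.1 (isOfFinOrder_of_finite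
      (((ρ : Lambda p G →* Matrix ι ι (ZMod p)).comp (lambdaOf p)).toHomUnits γ))
    exact ⟨m, hm, congrArg Units.val h⟩
  -- `γ ^ m` acts as the scalar `(1 + X) ^ m`.
  have hpow (j : ℕ) : ΘK (lambdaOf p (γ ^ (m * j))) =
      Matrix.scalar ι (algebraMap (ZMod p)⟦X⟧ K ((1 + X) ^ (m * j))) := by
    have h1 : onePlusXPow p (χ (γ ^ (m * j))) = (1 + X) ^ (m * j) := by
      rw [map_pow, hγ, ← onePlusXPow_natCast, ← ofAdd_nsmul, nsmul_one]
    have h2 : ρ (lambdaOf p (γ ^ (m * j))) = 1 := by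
      rw [map_pow, map_pow, pow_mul, hγm, one_pow]
    rw [hΘK, RingHom.comp_apply, hΘ, h1, h2, map_one, mul_one, mapMatrix_scalar]
  have hfin : Finite (Set.range T) := Set.finite_range T
  obtain ⟨j, j', hne, h⟩ := Finite.exists_ne_map_eq_of_infinite fun j : ℕ =>
    (⟨_, hT (lambdaOf p (γ ^ (m * j)))⟩ : Set.range T)
  rw [Subtype.mk.injEq, hpow, hpow] at h
  funext i
  by_contra hi
  have hj := congrFun h i
  simp only [Matrix.scalar_apply, Matrix.mulVec_diagonal] at hj
  have := IsFractionRing.injective (ZMod p)⟦X⟧ K (mul_right_cancel₀ hi hj)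
  exact hne (Nat.eq_of_mul_eq_mul_left hm (one_add_X_pow_injective _ this))

/-- Modules that become isomorphic after localisation have equally many homomorphisms to every
representation of a finite quotient of `G` over `𝔽_p`: deform the representation along `χ`; the
dimension of the homomorphisms is the same in the special and in the generic fibre, and the latter
is a module over the localisation. -/
theorem card_hom_matrixModule_eq {ι : Type u} [Fintype ι] [DecidableEq ι] (H : Subgroup G)
    (χ : G →* Multiplicative ℤ_[p]) (hχc : Continuous χ) (hχ : Function.Surjective χ)
    (hH : H ≤ χ.ker) {U : OpenNormalSubgroup G} (ρ : Lambda p G →+* Matrix ι ι (ZMod p))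
    (hρ : ∀ r, lambdaProj p U r = 0 → ρ r = 0) (P Q : FGProj (Lambda p G))
    (α : BaseChange (toLoc (canonicalOreSet p H)) P ≃ₗ[Loc (canonicalOreSet p H)]
      BaseChange (toLoc (canonicalOreSet p H)) Q) :
    Nat.card (P →ₗ[Lambda p G] MatrixModule ρ) = Nat.card (Q →ₗ[Lambda p G] MatrixModule ρ) := by
  obtain ⟨Θ, h1, h2, h3⟩ := exists_deformation p χ hχc ρ hρ
  let K := FractionRing (ZMod p)⟦X⟧
  obtain ⟨ΘS, hΘS, -⟩ := existsUnique_lift (S := canonicalOreSet p H)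
    ((algebraMap (ZMod p)⟦X⟧ K).mapMatrix.comp Θ)
    fun s hs => isUnit_deformation p H χ hχ ρ Θ h2 (h3 H hH) K hs
  have hrank := MatrixModule.finrank_hom_comp_eq (ZMod p)⟦X⟧ _ ΘS P Q α
  rw [hΘS] at hrank
  have hloc (P : FGProj (Lambda p G)) :=
    have := MatrixModule.isLocalizedModule_homMap P K Θ
    IsLocalizedModule.finrank_eq (nonZeroDivisors (ZMod p)⟦X⟧)
      (MatrixModule.homMap P K Θ) le_rfl
  rw [hloc, hloc] at hrank
  obtain rfl : (constantCoeff (R := ZMod p)).mapMatrix.comp Θ = ρ := RingHom.ext h1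
  rw [MatrixModule.card_hom_constantCoeff, MatrixModule.card_hom_constantCoeff, hrank]

/-- Every finite `Λ(G)`-module killed by `p` on which `Λ(G)` acts through a finite level is, after
the choice of a basis, a matrix representation over `𝔽_p`. -/
theorem card_hom_eq (H : Subgroup G)
    (χ : G →* Multiplicative ℤ_[p]) (hχc : Continuous χ) (hχ : Function.Surjective χ)
    (hH : H ≤ χ.ker) {U : OpenNormalSubgroup G} (P Q : FGProj (Lambda p G))
    (α : BaseChange (toLoc (canonicalOreSet p H)) P ≃ₗ[Loc (canonicalOreSet p H)]
      BaseChange (toLoc (canonicalOreSet p H)) Q)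
    (V : Type u) [AddCommGroup V] [Module (Lambda p G) V] [Module (ZMod p) V] [Finite V]
    (hU : ∀ r, lambdaProj p U r = 0 → ∀ v : V, r • v = 0) :
    Nat.card (P →ₗ[Lambda p G] V) = Nat.card (Q →ₗ[Lambda p G] V) := by
  let b := Module.Basis.ofVectorSpace (ZMod p) V
  have := Fintype.ofFinite (Module.Basis.ofVectorSpaceIndex (ZMod p) V)
  classical
  have : SMulCommClass (Lambda p G) (ZMod p) V :=
    ⟨fun r c v => ZMod.map_smul (DistribSMul.toAddMonoidHom V r) c v⟩
  let act : Lambda p G →+* Module.End (ZMod p) V := Module.toModuleEnd (ZMod p) V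
  let ρ := (LinearMap.toMatrixAlgEquiv b).toRingEquiv.toRingHom.comp act
  have hρ (r : Lambda p G) (hr : lambdaProj p U r = 0) : ρ r = 0 := by
    have : act r = 0 := LinearMap.ext fun v => hU r hr v
    rw [RingHom.comp_apply, this, map_zero]
  let e : V ≃ₗ[Lambda p G] MatrixModule ρ :=
    { b.equivFun.toAddEquiv with
      map_smul' := fun r v => (LinearMap.toMatrix_mulVec_repr b b (act r) v).symm }
  have he (P : FGProj (Lambda p G)) :
      Nat.card (P →ₗ[Lambda p G] V) = Nat.card (P →ₗ[Lambda p G] MatrixModule ρ) :=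
    Nat.card_congr
      { toFun := fun f => e.toLinearMap ∘ₗ f
        invFun := fun f => e.symm.toLinearMap ∘ₗ f
        left_inv := fun f => by ext; simp
        right_inv := fun f => by ext x; simp }
  rw [he, he]
  exact card_hom_matrixModule_eq p H χ hχc hχ hH ρ hρ P Q α

end Localisation

/-! ### Isomorphisms over the localisation -/

/-- Finitely generated projective `Λ(G)`-modules that become isomorphic over `Λ(G)_S` are
isomorphic. -/
theorem nonempty_linearEquiv_of_baseChange (p : ℕ) [Fact p.Prime] {G : Type u} [Group G]
    [TopologicalSpace G] [IsTopologicalGroup G] [CompactSpace G] (H : Subgroup G)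
    (χ : G →* Multiplicative ℤ_[p]) (hχc : Continuous χ) (hχ : Function.Surjective χ)
    (hH : H ≤ χ.ker) (P Q : FGProj (Lambda p G))
    (α : BaseChange (toLoc (canonicalOreSet p H)) P ≃ₗ[Loc (canonicalOreSet p H)]
      BaseChange (toLoc (canonicalOreSet p H)) Q) : Nonempty (P ≃ₗ[Lambda p G] Q) :=
  nonempty_linearEquiv_of_card_eq p P Q fun V _ _ _ _ hU hp =>
    have : Module (ZMod p) V := AddCommGroup.zmodModule fun v => by
      rw [← Nat.cast_smul_eq_nsmul (Lambda p G), hp]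
    card_hom_eq p H χ hχc hχ hH P Q α V hU

/-- The cyclotomic character `Gal(L/F) → Gal(F^cyc/F) ≅ ℤ_p`. -/
theorem exists_cyclotomicCharacter (p : ℕ) [Fact p.Prime] (F : Type v) [Field F]
    (L : Type u) [Field L] [Algebra F L] [IsGalois F L] (Fcyc : IntermediateField F L)
    (h : IsCyclotomicZpExtension p F Fcyc) :
    ∃ χ : Gal(L/F) →* Multiplicative ℤ_[p], Continuous χ ∧ Function.Surjective χ ∧
      Fcyc.fixingSubgroup ≤ χ.ker := by
  have := h.isGalois
  obtain ⟨e⟩ := h.galois_group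
  refine ⟨(e : Gal(Fcyc/F) →* Multiplicative ℤ_[p]).comp (AlgEquiv.restrictNormalHom Fcyc),
    e.continuous.comp (InfiniteGalois.restrictNormalHom_continuous Fcyc),
    e.surjective.comp (AlgEquiv.restrictNormalHom_surjective L), fun g hg => ?_⟩
  rw [← IntermediateField.restrictNormalHom_ker, MonoidHom.mem_ker] at hg
  rw [MonoidHom.mem_ker, MonoidHom.comp_apply, hg, map_one]

end

end NCIwasawa

theorem mainTheorem11 (p : ℕ) [Fact p.Prime] (hp : p ≠ 2)
    (F : Type v) [Field F] [NumberField F] [NumberField.IsTotallyReal F]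
    (L : Type u) [Field L] [Algebra F L] (Fcyc : IntermediateField F L)
    (hL : NCIwasawa.IsAdmissible p F L Fcyc) :
    Function.Surjective (NCIwasawa.boundary
      (NCIwasawa.toLoc (NCIwasawa.canonicalOreSet p Fcyc.fixingSubgroup))) ∧
    NCIwasawa.eta
      (NCIwasawa.toLoc (NCIwasawa.canonicalOreSet p Fcyc.fixingSubgroup)) = 0 := by
  have := hL.isGalois
  obtain ⟨χ, hχc, hχ, hH⟩ := NCIwasawa.exists_cyclotomicCharacter p F L Fcyc hL.cyclotomic
  have key := NCIwasawa.nonempty_linearEquiv_of_baseChange p Fcyc.fixingSubgroup χ hχc hχ hH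
  exact ⟨NCIwasawa.boundary_surjective_of_nonempty_linearEquiv _ key,
    NCIwasawa.eta_eq_zero_of_nonempty_linearEquiv _ key⟩
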